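/- For $n>1$ let $\Delta_n=\{(p_1,\dots,p_n): p_k\ge 0,\ \sum_k p_k=1\}$ and let $q>0$ be fixed. Write $u\oplus_q v=u+v+(1-q)uv$, let $p_k^{(q)}=p_k^q/\sum_{i} p_i^q$ be the $q$-escort probabilities of $P\in\Delta_n$, and let $U_n=(1/n,\dots,1/n)$. Let $\mathcal D_n:\Delta_n\to\mathbb R$ ($n>1$) be a family of functions, let $J=\bigcup_{n>1}\mathcal D_n(\Delta_n)$ be the set of its values, and let $f_h$ be a real function. We say that $(\mathcal D_n)$ satisfies the generalized Shannon–Khinchin axioms [A1]–[A4] with generator $f_h$ if $\mathcal D_n\ge 0$ for all $n>1$ and - [A1] each $\mathcal D_n$, $n>1$, is continuous on $\Delta_n$; - [A2] $\mathcal D_n(P)\le\mathcal D_n(U_n)$ for all $n>1$ and $P\in\Delta_n$; - [A3] $\mathcal D_{n+1}(p_1,\dots,p_n,0)=\mathcal D_n(p_1,\dots,p_n)$ for all $n>1$ and $(p_1,\dots,p_n)\in\Delta_n$; - [A4] $f_h$ is continuous and injective on $J$, and for all $n,m>1$ and all $PQ=(r_{11},r_{12},\dots,r_{nm})\in\Delta_{nm}$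 with $P=(p_1,\dots,p_n)$, $p_i=\sum_{j=1}^m r_{ij}$, and $Q_{|i}=(r_{i1}/p_i,\dots,r_{im}/p_i)\in\Delta_m$ (an arbitrary element of $\Delta_m$ if $p_i=0$), $$\mathcal D_{nm}(PQ)=\mathcal D_n(P)\oplus_q \mathcal D_m(Q|P),\qquad \mathcal D_m(Q|P)=f_h^{-1}\Big(\sum_{i=1}^n p_i^{(q)} f_h(\mathcal D_m(Q_{|i}))\Big),$$ where $f_h^{-1}$ is the inverse of $f_h|_J$. Then: 1. The functions $\mathcal D_n$ are not all constant and satisfy [A1]–[A4] with some generator $f_h$ if and only if there is $\tau<0$ such that, for all $n>1$ and $P\in\Delta_n$, $$\mathcal D_n(P)=\begin{cases}\tau\sum_{k=1}^n p_k\log_2 p_k, & q=1,\\[2pt] \dfrac{1}{1-q}\Big(\big(\sum_{k=1}^n p_k^q\big)^{-\tau}-1\Big), & q\neq 1,\end{cases}$$ where $0\log_2 0=0$. 2. If $\mathcal D_n$ has this form for some $\tau<0$, then $(\mathcal D_n)$ satisfies [A1]–[A4] with generator $f_h$ if and only if there are real $a\neq 0$ and $b$ such that $f_h(x)=a\,f_\tau(x)+b$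 for all $x\in J$, where $f_\tau(x)=\tau x$ if $q=1$ and $f_\tau(x)=((1-q)x+1)^{-1/\tau}$ if $q\neq 1$. -/

import Mathlib

noncomputable section

namespace GSK

/-- `Δ n` is the set of all `n`-dimensional probability distributions. -/
abbrev Δ (n : ℕ) : Type := stdSimplex ℝ (Fin n)

/-- The uniform distribution `U_n`. -/
def uniform (n : ℕ) (hn : 2 ≤ n) : Δ n :=
  ⟨fun _ => 1 / (n : ℝ), fun _ => by positivity, by
    have : (n : ℝ) ≠ 0 := by
      have : n ≠ 0 := by omega
      exact_mod_cast this
    simp [this]⟩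

/-- `(p₁, …, pₙ) ↦ (p₁, …, pₙ, 0)`. -/
def expand {n : ℕ} (P : Δ n) : Δ (n + 1) :=
  ⟨Fin.snoc (α := fun _ => ℝ) P.1 0, by
    refine ⟨fun i => ?_, ?_⟩
    · refine Fin.lastCases ?_ (fun j => ?_) i
      · simp
      · simpa using P.2.1 j
    · rw [Fin.sum_univ_castSucc]
      simpa using P.2.2⟩

/-- The `q`-escort distribution: `p_k ^ q / ∑ i, p_i ^ q`. -/
def escort (q : ℝ) {n : ℕ} (P : Δ n) (k : Fin n) : ℝ :=
  P.1 k ^ q / ∑ i, P.1 i ^ q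

/-- `u ⊕_q v = u + v + (1 - q) u v`. -/
def qAdd (q u v : ℝ) : ℝ := u + v + (1 - q) * u * v

/-- The set of all values taken by the functions `D n`, `n > 1`. -/
def values (D : (n : ℕ) → Δ n → ℝ) : Set ℝ :=
  {x | ∃ n : ℕ, 2 ≤ n ∧ ∃ P : Δ n, D n P = x}

/-- The conditional entropy `D_m(Q|P) = f⁻¹ (∑ i, p_i^{(q)} f (D_m(Q_{|i})))`, where `f⁻¹` is the
inverse of the restriction of `f` to the set of values of the entropy. -/
def condEntropy (q : ℝ) (D : (n : ℕ) → Δ n → ℝ) (f : ℝ → ℝ) {n m : ℕ}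
    (P : Δ n) (Q : Fin n → Δ m) : ℝ :=
  Function.invFunOn f (values D) (∑ i, escort q P i * f (D m (Q i)))

/-- The generalized Shannon–Khinchin axioms for a family `D n : Δ n → [0, ∞)`, `n > 1`, with
parameter `q` and generator `f`. The functions `D 0` and `D 1` play no role. -/
structure Axioms (q : ℝ) (D : (n : ℕ) → Δ n → ℝ) (f : ℝ → ℝ) : Prop where
  /-- The functions take values in `[0, ∞)`. -/
  nonneg : ∀ n, 2 ≤ n → ∀ P : Δ n, 0 ≤ D n P
  /-- Continuity. -/
  continuous : ∀ n, 2 ≤ n → Continuous (D n)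
  /-- Maximality at the uniform distribution. -/
  maximal : ∀ n, ∀ hn : 2 ≤ n, ∀ P : Δ n, D n P ≤ D n (uniform n hn)
  /-- Expandability. -/
  expandable : ∀ n, 2 ≤ n → ∀ P : Δ n, D (n + 1) (expand P) = D n P
  /-- The generator is continuous on the values of the entropy. -/
  gen_continuous : ContinuousOn f (values D)
  /-- The generator is invertible on the values of the entropy. -/
  gen_invertible : Set.InjOn f (values D)
  /-- `q`-additivity. `R` lists the joint probabilities `r_{ij}` in the order
  `r₁₁, r₁₂, …, r_{nm}`, `P` is its marginal and `Q i` is the conditional distribution `Q_{|i}`.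
  If `p_i = 0`, then `Q_{|i}` can be any distribution; its weight is zero. -/
  additive : ∀ n m, 2 ≤ n → 2 ≤ m → ∀ (R : Δ (n * m)) (P : Δ n) (Q : Fin n → Δ m),
    (∀ i, P.1 i = ∑ j, R.1 (finProdFinEquiv (i, j))) →
    (∀ i, P.1 i ≠ 0 → ∀ j, (Q i).1 j = R.1 (finProdFinEquiv (i, j)) / P.1 i) →
    D (n * m) R = qAdd q (D n P) (condEntropy q D f P Q)

/-- At least one of the functions `D n`, `n > 1`, is not constant. -/
def Nonconstant (D : (n : ℕ) → Δ n → ℝ) : Prop :=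
  ∃ n : ℕ, 2 ≤ n ∧ ∃ P P' : Δ n, D n P ≠ D n P'

/-- The entropy with parameters `q` and `τ`. -/
def entropy (q τ : ℝ) {n : ℕ} (P : Δ n) : ℝ :=
  if q = 1 then τ * ∑ k, P.1 k * Real.logb 2 (P.1 k)
  else 1 / (1 - q) * ((∑ k, P.1 k ^ q) ^ (-τ) - 1)

/-- The generator with parameters `q` and `τ`. -/
def generator (q τ x : ℝ) : ℝ :=
  if q = 1 then τ * x else ((1 - q) * x + 1) ^ (-1 / τ)

end GSK

end

/-!
In the coordinate `h` with `x = (exp ((1 - q) h) - 1) / (1 - q)`, the operation `⊕_q` is ordinary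
addition. Taking the product of a two-block distribution with an independent third one, either as
a whole or block by block, shows that the quasi-arithmetic means with generator `f` commute with
translations, so `f` is affine in `exp (s h)`, or in `h` itself if `s = 0`. Reaching one
distribution by two different groupings ties `s` to the entropy of `U_2`.

For a given generator, additivity and monotonicity determine the entropy along the uniform
distributions from its value at `U_2`. Grouping a uniform distribution into two blocks gives the
rational binary distributions, continuity gives all binary ones, and splitting off one point at a
time gives the rest.

Conversely, in the coordinate `h` the explicit entropy is a multiple of the Tsallis entropy, whose
chain rule is a direct computation.
-/

open Filter Topology

namespace GSK

section QAddition

/-- The isomorphism from the addition of the reals onto `qAdd q`, inverse to `toAdd q`. -/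
noncomputable def ofAdd (q h : ℝ) : ℝ :=
  if q = 1 then h else (Real.exp ((1 - q) * h) - 1) / (1 - q)

/-- The coordinate in which `qAdd q` is the addition of the reals. It is meaningful only at those
`x` that satisfy `0 < 1 + (1 - q) * x`. -/
noncomputable def toAdd (q x : ℝ) : ℝ :=
  if q = 1 then x else Real.log (1 + (1 - q) * x) / (1 - q)

/-- The scalar multiplication that belongs to the addition `qAdd q`. -/
noncomputable def qSmul (q t x : ℝ) : ℝ := ofAdd q (t * toAdd q x)

variable {q s t x y : ℝ}

@[simp] lemma ofAdd_one (h : ℝ) : ofAdd 1 h = h := if_pos rfl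

@[simp] lemma toAdd_one (x : ℝ) : toAdd 1 x = x := if_pos rfl

lemma one_add_ofAdd (q h : ℝ) : 1 + (1 - q) * ofAdd q h = Real.exp ((1 - q) * h) := by
  rcases eq_or_ne q 1 with rfl | hq
  · simp
  · rw [ofAdd, if_neg hq, mul_div_cancel₀ _ (sub_ne_zero.2 hq.symm)]
    ring

lemma one_add_ofAdd_pos (q h : ℝ) : 0 < 1 + (1 - q) * ofAdd q h := by
  rw [one_add_ofAdd]
  exact Real.exp_pos _

@[simp] lemma toAdd_ofAdd (q h : ℝ) : toAdd q (ofAdd q h) = h := by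
  rcases eq_or_ne q 1 with rfl | hq
  · simp
  · rw [toAdd, if_neg hq, one_add_ofAdd, Real.log_exp,
      mul_div_cancel_left₀ _ (sub_ne_zero.2 hq.symm)]

lemma ofAdd_toAdd (hx : 0 < 1 + (1 - q) * x) : ofAdd q (toAdd q x) = x := by
  rcases eq_or_ne q 1 with rfl | hq
  · simp
  · have hq' : 1 - q ≠ 0 := sub_ne_zero.2 hq.symm
    rw [ofAdd, toAdd, if_neg hq, if_neg hq, mul_div_cancel₀ _ hq', Real.exp_log hx,
      add_sub_cancel_left, mul_div_cancel_left₀ _ hq']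

@[simp] lemma ofAdd_zero (q : ℝ) : ofAdd q 0 = 0 := by simp [ofAdd]

@[simp] lemma toAdd_zero (q : ℝ) : toAdd q 0 = 0 := by simp [toAdd]

lemma one_add_qAdd (q x y : ℝ) :
    1 + (1 - q) * qAdd q x y = (1 + (1 - q) * x) * (1 + (1 - q) * y) := by
  rw [qAdd]
  ring

@[simp] lemma qAdd_one (x y : ℝ) : qAdd 1 x y = x + y := by simp [qAdd]

lemma ofAdd_add (q h k : ℝ) : ofAdd q (h + k) = qAdd q (ofAdd q h) (ofAdd q k) := by
  rcases eq_or_ne q 1 with rfl | hq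
  · simp
  · refine mul_left_cancel₀ (sub_ne_zero.2 hq.symm) (add_left_cancel (a := 1) ?_)
    rw [one_add_qAdd, one_add_ofAdd, one_add_ofAdd, one_add_ofAdd, mul_add, Real.exp_add]

lemma toAdd_qAdd (hx : 0 < 1 + (1 - q) * x) (hy : 0 < 1 + (1 - q) * y) :
    toAdd q (qAdd q x y) = toAdd q x + toAdd q y := by
  rw [← ofAdd_toAdd hx, ← ofAdd_toAdd hy, ← ofAdd_add, toAdd_ofAdd, toAdd_ofAdd, toAdd_ofAdd]

lemma ofAdd_strictMono (q : ℝ) : StrictMono (ofAdd q) := by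
  intro h k hhk
  rcases lt_trichotomy q 1 with hq | rfl | hq
  · have : 0 < 1 - q := sub_pos.2 hq
    rw [ofAdd, ofAdd, if_neg hq.ne, if_neg hq.ne]
    gcongr
  · simpa using hhk
  · rw [ofAdd, ofAdd, if_neg hq.ne', if_neg hq.ne']
    have hneg : 1 - q < 0 := sub_neg.2 hq
    exact div_lt_div_of_neg_of_lt hneg
      (sub_lt_sub_right (Real.exp_lt_exp.2 (mul_lt_mul_of_neg_left hhk hneg)) 1)

lemma toAdd_le_toAdd_iff (hx : 0 < 1 + (1 - q) * x) (hy : 0 < 1 + (1 - q) * y) :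
    toAdd q x ≤ toAdd q y ↔ x ≤ y := by
  rw [← (ofAdd_strictMono q).le_iff_le, ofAdd_toAdd hx, ofAdd_toAdd hy]

lemma toAdd_nonneg (hx : 0 < 1 + (1 - q) * x) (hx0 : 0 ≤ x) : 0 ≤ toAdd q x := by
  rwa [← toAdd_zero q, toAdd_le_toAdd_iff (by simp) hx]

lemma continuous_ofAdd (q : ℝ) : Continuous (ofAdd q) := by
  unfold ofAdd
  split_ifs <;> fun_prop

lemma continuousOn_toAdd (q : ℝ) : ContinuousOn (toAdd q) {x | 0 < 1 + (1 - q) * x} := by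
  unfold toAdd
  split_ifs
  · fun_prop
  · exact ContinuousOn.div_const (ContinuousOn.log (by fun_prop) fun _ hx => ne_of_gt hx) _

lemma ofAdd_mul_eq {c : ℝ} (ht : t ≠ 0) (hc : (1 - s) * c = (1 - q) * t) (hc0 : c ≠ 0) (h : ℝ) :
    ofAdd s (c * h) = c / t * ofAdd q (t * h) := by
  have hexp : (1 - s) * (c * h) = (1 - q) * (t * h) := by rw [← mul_assoc, hc, mul_assoc]
  rcases eq_or_ne q 1 with rfl | hq
  · obtain rfl : s = 1 := by
      rw [sub_self, zero_mul] at hc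
      linarith [(mul_eq_zero.1 hc).resolve_right hc0]
    simp only [ofAdd_one]
    field_simp
  · have hq' : 1 - q ≠ 0 := sub_ne_zero.2 hq.symm
    have hs' : 1 - s ≠ 0 := left_ne_zero_of_mul (hc ▸ mul_ne_zero hq' ht)
    rw [ofAdd, ofAdd, if_neg hq, if_neg (sub_ne_zero.1 hs').symm, hexp, div_mul_div_comm,
      div_eq_div_iff hs' (mul_ne_zero ht hq')]
    linear_combination -(Real.exp ((1 - q) * (t * h)) - 1) * hc

lemma one_add_qSmul (hx : 0 < 1 + (1 - q) * x) (t : ℝ) :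
    1 + (1 - q) * qSmul q t x = (1 + (1 - q) * x) ^ t := by
  rw [qSmul, one_add_ofAdd, mul_left_comm, mul_comm t, Real.exp_mul, ← one_add_ofAdd,
    ofAdd_toAdd hx]

lemma one_add_qSmul_pos (q t x : ℝ) : 0 < 1 + (1 - q) * qSmul q t x := one_add_ofAdd_pos _ _

lemma qSmul_qSmul (q s t x : ℝ) : qSmul q s (qSmul q t x) = qSmul q (s * t) x := by
  rw [qSmul, qSmul, toAdd_ofAdd, ← mul_assoc, qSmul]

lemma qSmul_one (hx : 0 < 1 + (1 - q) * x) : qSmul q 1 x = x := by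
  rw [qSmul, one_mul, ofAdd_toAdd hx]

@[simp] lemma qSmul_zero (q t : ℝ) : qSmul q t 0 = 0 := by simp [qSmul]

lemma qSmul_qAdd (hx : 0 < 1 + (1 - q) * x) (hy : 0 < 1 + (1 - q) * y) (t : ℝ) :
    qSmul q t (qAdd q x y) = qAdd q (qSmul q t x) (qSmul q t y) := by
  rw [qSmul, toAdd_qAdd hx hy, mul_add, ofAdd_add, qSmul, qSmul]

lemma qSmul_le_qSmul (ht : 0 ≤ t) (hx : 0 < 1 + (1 - q) * x) (hy : 0 < 1 + (1 - q) * y)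
    (hxy : x ≤ y) : qSmul q t x ≤ qSmul q t y :=
  (ofAdd_strictMono q).monotone
    (mul_le_mul_of_nonneg_left ((toAdd_le_toAdd_iff hx hy).2 hxy) ht)

lemma continuousOn_qSmul (q t : ℝ) : ContinuousOn (qSmul q t) {x | 0 < 1 + (1 - q) * x} :=
  (continuous_ofAdd q).comp_continuousOn ((continuousOn_toAdd q).const_mul t)

end QAddition

section FunctionalEquations

open Set

lemma eq_mul_of_additive {g : ℝ → ℝ} (hc : ContinuousOn g (Ici 0))
    (hadd : ∀ x y, 0 ≤ x → 0 ≤ y → g (x + y) = g x + g y) {x : ℝ} (hx : 0 ≤ x) :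
    g x = x * g 1 := by
  have hzero : g 0 = 0 := by simpa using hadd 0 0 le_rfl le_rfl
  have hmul : ∀ (k : ℕ) {y : ℝ}, 0 ≤ y → g (k * y) = k * g y := fun k y hy => by
    induction k with
    | zero => simp [hzero]
    | succ k ih => rw [Nat.cast_succ, add_one_mul, hadd _ _ (by positivity) hy, ih, add_one_mul]
  have hfrac : ∀ n : ℕ, n ≠ 0 → g (⌊x * n⌋₊ / n) = ⌊x * n⌋₊ / n * g 1 := fun n hn => by
    have hn' : (n : ℝ) ≠ 0 := Nat.cast_ne_zero.2 hn
    have hinv : g 1 = n * g (1 / n) := by rw [← hmul n (by positivity), mul_one_div_cancel hn']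
    rw [div_eq_mul_one_div, hmul _ (by positivity), hinv]
    field_simp
  have hlim : Tendsto (fun n : ℕ => (⌊x * n⌋₊ / n : ℝ)) atTop (𝓝 x) :=
    (tendsto_nat_floor_mul_div_atTop hx).comp tendsto_natCast_atTop_atTop
  have hlim' : Tendsto (fun n : ℕ => g (⌊x * n⌋₊ / n)) atTop (𝓝 (g x)) :=
    (hc x hx).tendsto.comp <| tendsto_nhdsWithin_iff.2
      ⟨hlim, .of_forall fun n => mem_Ici.2 (by positivity)⟩
  refine tendsto_nhds_unique hlim' ((hlim.mul_const (g 1)).congr' ?_)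
  filter_upwards [eventually_ne_atTop 0] with n hn
  exact (hfrac n hn).symm

lemma exists_eq_ofAdd {s : ℝ} {G : ℝ → ℝ} (hc : ContinuousOn G (Ici 0)) (hinj : InjOn G (Ici 0))
    (hG : ∀ x y, 0 ≤ x → 0 ≤ y → G (x + y) = qAdd s (G x) (G y)) :
    ∃ c, c ≠ 0 ∧ ∀ x, 0 ≤ x → G x = ofAdd s (c * x) := by
  have hmul : ∀ x y, 0 ≤ x → 0 ≤ y →
      1 + (1 - s) * G (x + y) = (1 + (1 - s) * G x) * (1 + (1 - s) * G y) := fun x y hx hy => by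
    rw [hG x y hx hy, one_add_qAdd]
  have hne : ∀ x, 0 ≤ x → 1 + (1 - s) * G x ≠ 0 := fun x hx h0 => by
    have h1 : 1 + (1 - s) * G (x + 1) = 0 := by rw [hmul x 1 hx zero_le_one, h0, zero_mul]
    have hs : 1 - s ≠ 0 := fun hs => by simp [hs] at h0
    have heq : G (x + 1) = G x := mul_left_cancel₀ hs (by linarith)
    linarith [hinj (mem_Ici.2 (by positivity)) hx heq]
  have hpos : ∀ x, 0 ≤ x → 0 < 1 + (1 - s) * G x := fun x hx => by
    have hx2 : 0 ≤ x / 2 := by positivity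
    rw [← add_halves x, hmul _ _ hx2 hx2]
    exact mul_self_pos.2 (hne _ hx2)
  have hlin : ∀ x, 0 ≤ x → toAdd s (G x) = x * toAdd s (G 1) := fun x hx =>
    eq_mul_of_additive (g := fun x => toAdd s (G x)) ((continuousOn_toAdd s).comp hc hpos)
      (fun x y hx hy => by rw [hG x y hx hy, toAdd_qAdd (hpos x hx) (hpos y hy)]) hx
  have hval : ∀ x, 0 ≤ x → G x = ofAdd s (toAdd s (G 1) * x) := fun x hx => by
    rw [mul_comm, ← hlin x hx, ofAdd_toAdd (hpos x hx)]
  refine ⟨toAdd s (G 1), fun h0 => zero_ne_one (α := ℝ) ?_, hval⟩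
  exact hinj (mem_Ici.2 le_rfl) (mem_Ici.2 zero_le_one)
    ((hval 0 le_rfl).trans <| by rw [h0, zero_mul, ← zero_mul 1, ← h0, ← hval 1 zero_le_one])

/-- The quasi-arithmetic means with generator `F` commute with translations of `[0, ∞)`. The mean
`z` of `x` and `y` is given by its defining equation, so that no inverse of `F` is involved. -/
def TranslativeMeans (F : ℝ → ℝ) : Prop :=
  ∀ ⦃x y z t w : ℝ⦄, 0 ≤ x → 0 ≤ y → 0 ≤ z → 0 ≤ t → w ∈ Icc 0 1 →
    F z = w * F x + (1 - w) * F y → F (z + t) = w * F (x + t) + (1 - w) * F (y + t)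

namespace TranslativeMeans

variable {F : ℝ → ℝ}

lemma cross_eq (hF : TranslativeMeans F) (hc : ContinuousOn F (Ici 0)) (hinj : InjOn F (Ici 0))
    {x y t : ℝ} (hx : 0 ≤ x) (hy : 0 ≤ y) (ht : 0 ≤ t) :
    (F (x + t) - F t) * (F y - F 0) = (F (y + t) - F t) * (F x - F 0) := by
  wlog hxy : x ≤ y generalizing x y
  · exact (this hy hx (le_of_not_ge hxy)).symm
  have hbetween : F x ∈ uIcc (F 0) (F y) := by
    have hmaps : MapsTo F (uIcc 0 y) (uIcc (F 0) (F y)) := by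
      have hsub : Icc 0 y ⊆ Ici 0 := Icc_subset_Ici_self
      rcases (hc.mono hsub).strictMonoOn_of_injOn_Icc' hy (hinj.mono hsub) with h | h
      · exact MonotoneOn.mapsTo_uIcc (by simpa only [uIcc_of_le hy] using h.monotoneOn)
      · exact AntitoneOn.mapsTo_uIcc (by simpa only [uIcc_of_le hy] using h.antitoneOn)
    exact hmaps (uIcc_of_le hy ▸ ⟨hx, hxy⟩)
  rw [← segment_eq_uIcc] at hbetween
  obtain ⟨a, b, ha, hb, hab, hFx⟩ := hbetween
  obtain rfl : b = 1 - a := by linarith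
  have hFx' : F x = a * F 0 + (1 - a) * F y := hFx.symm
  have hFxt : F (x + t) = a * F t + (1 - a) * F (y + t) := by
    simpa using hF le_rfl hy hx ht ⟨ha, by linarith⟩ hFx'
  rw [hFx', hFxt]
  ring

lemma exists_eq_ofAdd_add (hF : TranslativeMeans F) (hc : ContinuousOn F (Ici 0))
    (hinj : InjOn F (Ici 0)) :
    ∃ s c b, c ≠ 0 ∧ ∀ x, 0 ≤ x → F x = ofAdd s (c * x) + b := by
  have hd : F 1 - F 0 ≠ 0 := sub_ne_zero.2 fun h =>
    one_ne_zero (hinj (mem_Ici.2 zero_le_one) (mem_Ici.2 le_rfl) h)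
  -- The slope of `F (· + t)` against `F` is affine in `F t`, with leading coefficient `κ`.
  set κ := ((F 2 - F 1) / (F 1 - F 0) - 1) / (F 1 - F 0) with hκ
  have hslope : ∀ t, 0 ≤ t → F (1 + t) - F t = (1 + κ * (F t - F 0)) * (F 1 - F 0) :=
    fun t ht => by
      have h := hF.cross_eq hc hinj zero_le_one ht zero_le_one
      rw [one_add_one_eq_two, add_comm t] at h
      rw [hκ]
      field_simp
      linear_combination -h
  obtain ⟨c, hc0, hG⟩ := exists_eq_ofAdd (s := 1 - κ) (G := fun x => F x - F 0)
    (hc.sub continuousOn_const) (fun x hx y hy h => hinj hx hy (sub_left_inj.1 h))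
    (fun x y hx hy => by
      have h := hF.cross_eq hc hinj hx zero_le_one hy
      rw [hslope y hy] at h
      rw [qAdd]
      exact mul_right_cancel₀ hd (by linear_combination h))
  exact ⟨1 - κ, c, F 0, hc0, fun x hx => by rw [← hG x hx, sub_add_cancel]⟩

end TranslativeMeans

end FunctionalEquations

open Finset

section Distributions

/-- `p` is a probability distribution on `ℕ` supported in `{0, …, n - 1}`. Distributions of
different lengths are thus objects of the same type, and expansion by zeros is the identity. -/
structure IsDist (n : ℕ) (p : ℕ → ℝ) : Prop where
  nonneg : ∀ i, 0 ≤ p i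
  eq_zero : ∀ i, n ≤ i → p i = 0
  sum_eq_one : ∑ i ∈ range n, p i = 1

/-- The joint distribution with marginal `P` and conditional distributions `Q i`, listed in
consecutive blocks of length `m`. -/
noncomputable def joint (m : ℕ) (P : ℕ → ℝ) (Q : ℕ → ℕ → ℝ) (k : ℕ) : ℝ :=
  P (k / m) * Q (k / m) (k % m)

/-- The uniform distribution on `{0, …, n - 1}`; `unif 1` is the point mass at `0`. -/
noncomputable def unif (n i : ℕ) : ℝ := if i < n then 1 / (n : ℝ) else 0

/-- The distribution `(p, 1 - p, 0, 0, …)`. -/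
noncomputable def binary (p : ℝ) (i : ℕ) : ℝ := if i = 0 then p else if i = 1 then 1 - p else 0

/-- The grouping of two distributions into `(p A, (1 - p) B)`, with `m` entries for `A`. -/
noncomputable def mix (m : ℕ) (p : ℝ) (A B : ℕ → ℝ) (k : ℕ) : ℝ :=
  if k < m then p * A k else (1 - p) * B (k - m)

variable {m n : ℕ} {p : ℝ} {P A B : ℕ → ℝ} {Q : ℕ → ℕ → ℝ}

namespace IsDist

lemma mono (h : IsDist m P) (hmn : m ≤ n) : IsDist n P where
  nonneg := h.nonneg
  eq_zero i hi := h.eq_zero i (hmn.trans hi)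
  sum_eq_one := by
    rw [← h.sum_eq_one]
    exact (sum_subset (range_mono hmn) fun i _ hi => h.eq_zero i (by simpa using hi)).symm

lemma le_one (h : IsDist n P) (i : ℕ) : P i ≤ 1 := by
  rcases lt_or_ge i n with hi | hi
  · exact h.sum_eq_one ▸ single_le_sum (fun j _ => h.nonneg j) (mem_range.2 hi)
  · exact (h.eq_zero i hi).trans_le zero_le_one

lemma pos (h : IsDist n P) : 0 < n :=
  Nat.pos_of_ne_zero fun hn => by simpa [hn] using h.sum_eq_one

lemma exists_pos (h : IsDist n P) : ∃ i < n, 0 < P i := by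
  by_contra! hc
  have := sum_nonpos fun i hi => hc i (mem_range.1 hi)
  linarith [h.sum_eq_one]

lemma eq_binary (h : IsDist 2 P) : P = binary (P 0) := by
  have hsum : P 0 + P 1 = 1 := by simpa [sum_range_succ] using h.sum_eq_one
  funext i
  rcases i with _ | _ | i
  · simp [binary]
  · simp [binary, ← hsum]
  · simp [binary, h.eq_zero (i + 2) (by lia)]

end IsDist

lemma convex_setOf_isDist (n : ℕ) : Convex ℝ {P | IsDist n P} := by
  rintro P hP P' hP' a b ha hb hab
  refine ⟨fun i => ?_, fun i hi => ?_, ?_⟩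
  · have := hP.nonneg i
    have := hP'.nonneg i
    simp only [Pi.add_apply, Pi.smul_apply, smul_eq_mul]
    positivity
  · simp [hP.eq_zero i hi, hP'.eq_zero i hi]
  · simp [sum_add_distrib, ← mul_sum, hP.sum_eq_one, hP'.sum_eq_one, hab]

lemma unif_of_lt {i : ℕ} (hi : i < n) : unif n i = 1 / n := if_pos hi

lemma mix_of_lt (p : ℝ) (A B : ℕ → ℝ) {k : ℕ} (hk : k < m) : mix m p A B k = p * A k := if_pos hk

lemma isDist_unif (hn : 1 ≤ n) : IsDist n (unif n) := by
  refine ⟨fun i => ?_, fun i hi => if_neg hi.not_gt, ?_⟩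
  · unfold unif
    positivity
  · have hn' : (n : ℝ) ≠ 0 := by positivity
    rw [sum_congr rfl fun i hi => unif_of_lt (mem_range.1 hi)]
    simp [hn']

lemma isDist_binary (h0 : 0 ≤ p) (h1 : p ≤ 1) : IsDist 2 (binary p) := by
  refine ⟨fun i => ?_, fun i hi => ?_, ?_⟩
  · unfold binary
    split_ifs <;> linarith
  · simp [binary, show i ≠ 0 by lia, show i ≠ 1 by lia]
  · simp [sum_range_succ, binary]

lemma isDist_mix (h0 : 0 ≤ p) (h1 : p ≤ 1) (hA : IsDist m A) (hB : IsDist n B) :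
    IsDist (m + n) (mix m p A B) := by
  refine ⟨fun i => ?_, fun i hi => ?_, ?_⟩
  · have := hA.nonneg i
    have := hB.nonneg (i - m)
    have := sub_nonneg.2 h1
    unfold mix
    split_ifs <;> positivity
  · simp [mix, show ¬ i < m by lia, hB.eq_zero (i - m) (by lia)]
  · rw [sum_range_add, sum_congr rfl fun i hi => mix_of_lt p A B (mem_range.1 hi)]
    simp [mix, ← mul_sum, hA.sum_eq_one, hB.sum_eq_one]

lemma joint_apply (P : ℕ → ℝ) (Q : ℕ → ℕ → ℝ) (i : ℕ) {j : ℕ} (hj : j < m) :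
    joint m P Q (i * m + j) = P i * Q i j := by
  have hdiv : (i * m + j) / m = i := by
    rw [mul_comm, Nat.mul_add_div (by lia), Nat.div_eq_of_lt hj, add_zero]
  have hmod : (i * m + j) % m = j := by rw [Nat.mul_add_mod', Nat.mod_eq_of_lt hj]
  rw [joint, hdiv, hmod]

lemma sum_range_mul (g : ℕ → ℝ) (n m : ℕ) :
    ∑ k ∈ range (n * m), g k = ∑ i ∈ range n, ∑ j ∈ range m, g (i * m + j) := by
  induction n with
  | zero => simp
  | succ n ih => rw [Nat.succ_mul, sum_range_add, ih, sum_range_succ]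

lemma isDist_joint (hm : 0 < m) (hP : IsDist n P) (hQ : ∀ i < n, IsDist m (Q i)) :
    IsDist (n * m) (joint m P Q) := by
  have hzero : ∀ k, n ≤ k / m → joint m P Q k = 0 := fun k hk => by
    rw [joint, hP.eq_zero _ hk, zero_mul]
  refine ⟨fun k => ?_, fun k hk => hzero k ((Nat.le_div_iff_mul_le hm).2 hk), ?_⟩
  · rcases lt_or_ge (k / m) n with hk | hk
    · exact mul_nonneg (hP.nonneg _) ((hQ _ hk).nonneg _)
    · exact (hzero k hk).ge
  · rw [sum_range_mul, ← hP.sum_eq_one]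
    refine sum_congr rfl fun i hi => ?_
    rw [sum_congr rfl fun j hj => joint_apply P Q i (mem_range.1 hj), ← mul_sum,
      (hQ i (mem_range.1 hi)).sum_eq_one, mul_one]

lemma joint_congr {Q' : ℕ → ℕ → ℝ} (hP : IsDist n P) (hQ : ∀ i < n, Q i = Q' i) :
    joint m P Q = joint m P Q' := by
  funext k
  rcases lt_or_ge (k / m) n with hk | hk
  · rw [joint, joint, hQ _ hk]
  · rw [joint, joint, hP.eq_zero _ hk, zero_mul, zero_mul]

lemma joint_unif_one (hP : IsDist m P) : joint m (unif 1) (fun _ => P) = P := by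
  funext k
  rcases lt_or_ge k m with hk | hk
  · simp [joint, unif, Nat.div_eq_of_lt hk, Nat.mod_eq_of_lt hk]
  · have hdiv : ¬ k / m < 1 := not_lt.2 ((Nat.one_le_div_iff hP.pos).2 hk)
    rw [joint, unif, if_neg hdiv, zero_mul, hP.eq_zero k hk]

lemma joint_unif (hm : 0 < m) : joint m (unif n) (fun _ => unif m) = unif (n * m) := by
  funext k
  have hiff : k / m < n ↔ k < n * m := Nat.div_lt_iff_lt_mul hm
  by_cases hk : k < n * m
  · simp only [joint, unif, hiff, hk, Nat.mod_lt k hm, if_true]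
    push_cast
    ring
  · simp only [joint, unif, hiff, hk, if_false, zero_mul]

lemma joint_binary (p : ℝ) (A : ℕ → ℝ) (hB : IsDist m B) :
    joint m (binary p) (fun i => if i = 0 then A else B) = mix m p A B := by
  have hm := hB.pos
  funext k
  rcases lt_or_ge k m with hk | hk
  · simp [joint, mix, hk, Nat.div_eq_of_lt hk, Nat.mod_eq_of_lt hk, binary]
  obtain ⟨l, rfl⟩ := Nat.exists_eq_add_of_le hk
  have hdiv : (m + l) / m = l / m + 1 := by rw [Nat.add_div_left _ hm]
  rcases lt_or_ge l m with hl | hl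
  · simp [joint, mix, hdiv, binary, Nat.div_eq_of_lt hl, Nat.mod_eq_of_lt hl]
  · have hl' : l / m ≠ 0 := (Nat.div_pos hl hm).ne'
    simp [joint, mix, hdiv, binary, hl', hB.eq_zero l hl]

lemma joint_mix {k : ℕ} (hk : 0 < k) (p : ℝ) (A B : ℕ → ℝ) (T : ℕ → ℕ → ℝ) :
    joint k (mix m p A B) T = mix (m * k) p (joint k A T) (joint k B fun j => T (m + j)) := by
  funext i
  have hiff : i / k < m ↔ i < m * k := Nat.div_lt_iff_lt_mul hk
  by_cases hi : i < m * k
  · simp only [joint, mix, hiff, hi, if_true, mul_assoc]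
  · have hdiv : (i - m * k) / k = i / k - m := by rw [mul_comm, Nat.sub_mul_div]
    have hmod : (i - m * k) % k = i % k := by
      rw [mul_comm, Nat.sub_mul_mod (by rw [mul_comm]; exact not_lt.1 hi)]
    have hle : m ≤ i / k := not_lt.1 (hiff.not.2 hi)
    simp only [joint, mix, hiff, hi, if_false, hdiv, hmod, Nat.add_sub_cancel' hle, mul_assoc]

lemma joint_mix_half_unif_two :
    joint 2 (mix 2 (1 / 2) (unif 2) (unif 1)) (fun i => if i < 2 then unif 2 else unif 1) =
      mix 4 (1 / 2) (unif 4) (unif 1) := by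
  rw [joint_mix two_pos, joint_congr (isDist_unif one_le_two) fun i hi => if_pos hi,
    joint_unif two_pos]
  simp only [(Nat.le_add_right 2 _).not_gt, if_false, Nat.reduceMul]
  rw [joint_unif_one ((isDist_unif le_rfl).mono one_le_two)]

lemma mix_unif (m n : ℕ) : mix m (m / (m + n)) (unif m) (unif n) = unif (m + n) := by
  funext k
  rcases lt_or_ge k m with hk | hk
  · have hm : (m : ℝ) ≠ 0 := Nat.cast_ne_zero.2 (by lia)
    have hmn : (m + n : ℝ) ≠ 0 := by positivity
    simp only [mix, unif, hk, if_true, show k < m + n by lia, Nat.cast_add]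
    field_simp
  · by_cases hkn : k < m + n
    · have hn : (n : ℝ) ≠ 0 := Nat.cast_ne_zero.2 (by lia)
      have hmn : (m + n : ℝ) ≠ 0 := by positivity
      simp only [mix, unif, hk.not_gt, if_false, hkn, if_true, show k - m < n by lia,
        Nat.cast_add]
      field_simp
      ring
    · simp [mix, unif, hk.not_gt, hkn, show ¬ k - m < n by lia]

lemma binary_one : binary 1 = unif 1 := by
  funext i
  by_cases hi : i = 0 <;> simp [binary, unif, hi]

lemma binary_half : binary (1 / 2) = unif 2 := by
  funext i
  rcases i with _ | _ | i
  · simp [binary, unif]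
  · norm_num [binary, unif]
  · simp [binary, unif]

lemma IsDist.exists_eq_mix (hP : IsDist (n + 1) P) (hlast : P n ≠ 1) :
    ∃ A, IsDist n A ∧ P = mix n (1 - P n) A (unif 1) := by
  have hne : 1 - P n ≠ 0 := sub_ne_zero.2 hlast.symm
  refine ⟨fun i => if i < n then P i / (1 - P n) else 0, ⟨fun i => ?_, fun i hi => ?_, ?_⟩, ?_⟩
  · have := hP.nonneg i
    have := sub_nonneg.2 (hP.le_one n)
    positivity
  · exact if_neg hi.not_gt
  · rw [sum_congr rfl fun i hi => if_pos (mem_range.1 hi), ← sum_div,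
      div_eq_one_iff_eq hne, ← hP.sum_eq_one, sum_range_succ, add_sub_cancel_right]
  · funext k
    rcases lt_trichotomy k n with hk | rfl | hk
    · simp only [mix, hk, if_true]
      rw [mul_div_cancel₀ _ hne]
    · simp [mix, unif]
    · simp [mix, unif, hk.not_gt, hP.eq_zero k hk, show k - n ≠ 0 by lia]

end Distributions

section Escort

/-- The escort distribution of the first `n` terms of a sequence. -/
noncomputable def seqEscort (q : ℝ) (n : ℕ) (P : ℕ → ℝ) (i : ℕ) : ℝ :=
  P i ^ q / ∑ j ∈ range n, P j ^ q

/-- The first escort probability of the distribution `(p, 1 - p)`. -/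
noncomputable def escortWeight (q p : ℝ) : ℝ := p ^ q / (p ^ q + (1 - p) ^ q)

variable {q p : ℝ} {n : ℕ} {P : ℕ → ℝ}

lemma IsDist.sum_rpow_pos (h : IsDist n P) (q : ℝ) : 0 < ∑ i ∈ range n, P i ^ q := by
  obtain ⟨i, hi, hpos⟩ := h.exists_pos
  exact sum_pos' (fun j _ => Real.rpow_nonneg (h.nonneg j) q)
    ⟨i, mem_range.2 hi, Real.rpow_pos_of_pos hpos q⟩

lemma sum_seqEscort (h : IsDist n P) (q : ℝ) : ∑ i ∈ range n, seqEscort q n P i = 1 := by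
  simp only [seqEscort]
  rw [← sum_div, div_self (h.sum_rpow_pos q).ne']

lemma escortWeight_denom_pos (h0 : 0 ≤ p) (h1 : p ≤ 1) (q : ℝ) : 0 < p ^ q + (1 - p) ^ q := by
  simpa [sum_range_succ, binary] using (isDist_binary h0 h1).sum_rpow_pos q

lemma seqEscort_binary_zero (q p : ℝ) : seqEscort q 2 (binary p) 0 = escortWeight q p := by
  simp [seqEscort, escortWeight, sum_range_succ, binary]

lemma seqEscort_binary_one (h0 : 0 ≤ p) (h1 : p ≤ 1) (q : ℝ) :
    seqEscort q 2 (binary p) 1 = 1 - escortWeight q p := by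
  have h := sum_seqEscort (isDist_binary h0 h1) q
  rw [sum_range_succ, sum_range_one, seqEscort_binary_zero] at h
  linarith

lemma escortWeight_lt_one (h0 : 0 ≤ p) (h1 : p < 1) (q : ℝ) : escortWeight q p < 1 :=
  (div_lt_one (escortWeight_denom_pos h0 h1.le q)).2
    (lt_add_of_pos_right _ (Real.rpow_pos_of_pos (sub_pos.2 h1) q))

lemma escortWeight_half (q : ℝ) : escortWeight q (1 / 2) = 1 / 2 := by
  have : (0 : ℝ) < (1 / 2) ^ q := by positivity
  rw [escortWeight, show (1 : ℝ) - 1 / 2 = 1 / 2 by norm_num]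
  field_simp
  norm_num

lemma sum_seqEscort_mix_half_unif_two (hq : q ≠ 0) (x y : ℝ) :
    ∑ i ∈ range 4, seqEscort q 4 (mix 2 (1 / 2) (unif 2) (unif 1)) i * (if i < 2 then x else y) =
      (2 * x + 2 ^ q * y) / (2 + 2 ^ q) := by
  set C := mix 2 (1 / 2) (unif 2) (unif 1)
  have hC0 : C 0 = 1 / 4 := by norm_num [C, mix, unif]
  have hC1 : C 1 = 1 / 4 := by norm_num [C, mix, unif]
  have hC2 : C 2 = 1 / 2 := by norm_num [C, mix, unif]
  have hC3 : C 3 = 0 := by norm_num [C, mix, unif]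
  have hhalf : (1 / 2 : ℝ) ^ q = (2 ^ q)⁻¹ := by rw [one_div, Real.inv_rpow zero_le_two]
  have hquarter : (1 / 4 : ℝ) ^ q = (2 ^ q)⁻¹ * (2 ^ q)⁻¹ := by
    rw [show (1 / 4 : ℝ) = 1 / 2 * (1 / 2) by norm_num,
      Real.mul_rpow (by norm_num) (by norm_num), hhalf]
  simp only [sum_range_succ, range_zero, sum_empty, seqEscort, hC0, hC1, hC2, hC3, hhalf,
    hquarter, Real.zero_rpow hq, Nat.reduceLT, if_true, if_false]
  field_simp
  ring

lemma exists_escortWeight_eq (hq : 0 < q) {w : ℝ} (hw : w ∈ Set.Icc 0 1) :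
    ∃ p ∈ Set.Icc (0 : ℝ) 1, escortWeight q p = w := by
  have hcont : ContinuousOn (escortWeight q) (Set.Icc 0 1) := by
    unfold escortWeight
    exact ContinuousOn.div (Real.continuous_rpow_const hq.le).continuousOn
      ((Real.continuous_rpow_const hq.le).add
        ((Real.continuous_rpow_const hq.le).comp (continuous_const.sub continuous_id))).continuousOn
      fun p hp => (escortWeight_denom_pos hp.1 hp.2 q).ne'
  have h0 : escortWeight q 0 = 0 := by simp [escortWeight, hq.ne']
  have h1 : escortWeight q 1 = 1 := by simp [escortWeight, hq.ne']
  exact intermediate_value_Icc zero_le_one hcont (by rwa [h0, h1])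

end Escort

/-- The values of `D` on finitely supported distributions. -/
def seqValues (D : (ℕ → ℝ) → ℝ) : Set ℝ := {x | ∃ n p, IsDist n p ∧ D p = x}

lemma seqValues_comp (g : ℝ → ℝ) (D : (ℕ → ℝ) → ℝ) :
    seqValues (fun p => g (D p)) = g '' seqValues D := by
  ext x
  constructor
  · rintro ⟨n, p, hp, rfl⟩
    exact ⟨_, ⟨n, p, hp, rfl⟩, rfl⟩
  · rintro ⟨_, ⟨n, p, hp, rfl⟩, rfl⟩
    exact ⟨n, p, hp, rfl⟩

/-- The generalized Shannon–Khinchin axioms for a nonconstant function of finitely supported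
distributions. The parameter `r` of the addition and the parameter `q` of the escort distribution
are independent, since a change of coordinates turns `qAdd r` into the ordinary addition (`r = 1`)
but preserves `q`. In `chain`, the conditional entropy `y` is given by its defining equation. -/
structure IsSeqEntropy (r q : ℝ) (D : (ℕ → ℝ) → ℝ) (f : ℝ → ℝ) : Prop where
  nonneg : ∀ {n p}, IsDist n p → 0 ≤ D p
  continuousOn : ∀ n, ContinuousOn D {p | IsDist n p}
  maximal : ∀ {n p}, 2 ≤ n → IsDist n p → D p ≤ D (unif n)
  gen_continuousOn : ContinuousOn f (seqValues D)
  gen_injOn : Set.InjOn f (seqValues D)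
  chain : ∀ {n m P Q}, 2 ≤ n → 2 ≤ m → IsDist n P → (∀ i < n, IsDist m (Q i)) →
    ∃ y ∈ seqValues D, f y = ∑ i ∈ range n, seqEscort q n P i * f (D (Q i)) ∧
      D (joint m P Q) = qAdd r (D P) y
  nontrivial : (seqValues D).Nontrivial

section Transfer

/-- The element of the simplex given by the first `n` terms of a sequence. -/
def restrict {n : ℕ} {p : ℕ → ℝ} (h : IsDist n p) : Δ n :=
  ⟨fun i => p i, fun i => h.nonneg i, by rw [← h.sum_eq_one, sum_range]⟩

/-- The extension of an element of the simplex by zeros. -/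
noncomputable def extend {n : ℕ} (P : Δ n) (i : ℕ) : ℝ := if h : i < n then P.1 ⟨i, h⟩ else 0

/-- Expandability [A3] of a family of functions on the simplices. -/
def Expandable (D : (n : ℕ) → Δ n → ℝ) : Prop :=
  ∀ n, 2 ≤ n → ∀ P : Δ n, D (n + 1) (expand P) = D n P

open Classical in
/-- The function of finitely supported distributions given by an expandable family. -/
noncomputable def seqOf (D : (n : ℕ) → Δ n → ℝ) (p : ℕ → ℝ) : ℝ :=
  if h : ∃ n, 2 ≤ n ∧ IsDist n p then D _ (restrict h.choose_spec.2) else 0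

variable {q : ℝ} {D : (n : ℕ) → Δ n → ℝ} {f : ℝ → ℝ} {n m : ℕ} {p : ℕ → ℝ}

lemma extend_val (P : Δ n) (i : Fin n) : extend P i = P.1 i := dif_pos i.2

lemma isDist_extend (P : Δ n) : IsDist n (extend P) where
  nonneg i := by
    unfold extend
    split_ifs
    · exact P.2.1 _
    · exact le_rfl
  eq_zero i hi := dif_neg hi.not_gt
  sum_eq_one := by
    rw [sum_range, ← P.2.2]
    exact sum_congr rfl fun i _ => extend_val P i

lemma restrict_extend (P : Δ n) : restrict (isDist_extend P) = P :=
  Subtype.ext <| funext <| extend_val P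

lemma restrict_unif (hn : 2 ≤ n) : restrict (isDist_unif (one_le_two.trans hn)) = uniform n hn :=
  Subtype.ext <| funext fun i => unif_of_lt i.2

lemma expand_restrict (h : IsDist n p) : expand (restrict h) = restrict (h.mono n.le_succ) := by
  refine Subtype.ext <| funext <| Fin.lastCases ?_ fun i => ?_
  · simp [expand, restrict, h.eq_zero n le_rfl]
  · simp [expand, restrict]

lemma Expandable.restrict_mono (hD : Expandable D) (hn : 2 ≤ n) (hnm : n ≤ m) (h : IsDist n p) :
    D m (restrict (h.mono hnm)) = D n (restrict h) := by
  induction m, hnm using Nat.le_induction with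
  | base => rfl
  | succ k hk ih => rw [← ih, ← hD k (by lia), expand_restrict]

lemma seqOf_eq (hD : Expandable D) (hn : 2 ≤ n) (h : IsDist n p) :
    seqOf D p = D n (restrict h) := by
  have hex : ∃ n, 2 ≤ n ∧ IsDist n p := ⟨n, hn, h⟩
  rw [seqOf, dif_pos hex,
    ← hD.restrict_mono hex.choose_spec.1 (le_max_left _ n) hex.choose_spec.2,
    ← hD.restrict_mono hn (le_max_right hex.choose n) h]

lemma seqOf_extend (hD : Expandable D) (hn : 2 ≤ n) (P : Δ n) : seqOf D (extend P) = D n P := by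
  rw [seqOf_eq hD hn (isDist_extend P), restrict_extend]

lemma seqValues_seqOf (hD : Expandable D) : seqValues (seqOf D) = values D := by
  ext x
  constructor
  · rintro ⟨n, p, hp, rfl⟩
    exact ⟨n + 2, by lia, _, (seqOf_eq hD (by lia) (hp.mono (by lia))).symm⟩
  · rintro ⟨n, hn, P, rfl⟩
    exact ⟨n, extend P, isDist_extend P, seqOf_extend hD hn P⟩

lemma isPreconnected_values (hD : Expandable D) (hc : ∀ n, 2 ≤ n → Continuous (D n)) :
    IsPreconnected (values D) := by
  refine isPreconnected_of_forall (seqOf D (unif 1)) ?_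
  rintro _ ⟨n, hn, P, rfl⟩
  have : PreconnectedSpace (Δ n) :=
    isPreconnected_iff_preconnectedSpace.1 (convex_stdSimplex ℝ (Fin n)).isPreconnected
  refine ⟨Set.range (D n), Set.range_subset_iff.2 fun P' => ⟨n, hn, P', rfl⟩, ?_, ⟨P, rfl⟩,
    isPreconnected_range (hc n hn)⟩
  exact ⟨_, (seqOf_eq hD hn ((isDist_unif le_rfl).mono (by lia))).symm⟩

lemma sum_rpow_pos (P : Δ n) (q : ℝ) : 0 < ∑ i, P.1 i ^ q := by
  simpa only [sum_range, extend_val] using (isDist_extend P).sum_rpow_pos q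

lemma escort_nonneg (P : Δ n) (q : ℝ) (i : Fin n) : 0 ≤ escort q P i :=
  div_nonneg (Real.rpow_nonneg (P.2.1 i) q) (sum_rpow_pos P q).le

lemma sum_escort (P : Δ n) (q : ℝ) : ∑ i, escort q P i = 1 := by
  simp only [escort]
  rw [← sum_div, div_self (sum_rpow_pos P q).ne']

lemma condEntropy_spec (hD : Expandable D) (hc : ∀ n, 2 ≤ n → Continuous (D n))
    (hf : ContinuousOn f (values D)) (hm : 2 ≤ m) (P : Δ n) (Q : Fin n → Δ m) :
    condEntropy q D f P Q ∈ values D ∧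
      f (condEntropy q D f P Q) = ∑ i, escort q P i * f (D m (Q i)) := by
  have hconv : Convex ℝ (f '' values D) :=
    ((isPreconnected_values hD hc).image f hf).ordConnected.convex
  have hmem : ∑ i, escort q P i * f (D m (Q i)) ∈ f '' values D :=
    hconv.sum_mem (fun i _ => escort_nonneg P q i) (sum_escort P q)
      fun i _ => Set.mem_image_of_mem f ⟨m, hm, Q i, rfl⟩
  exact ⟨Function.invFunOn_mem hmem, Function.invFunOn_eq hmem⟩

lemma Axioms.seqOf_chain (h : Axioms q D f) (hn : 2 ≤ n) (hm : 2 ≤ m) {P : ℕ → ℝ}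
    {Q : ℕ → ℕ → ℝ} (hP : IsDist n P) (hQ : ∀ i < n, IsDist m (Q i)) :
    ∃ y ∈ values D, f y = ∑ i ∈ range n, seqEscort q n P i * f (seqOf D (Q i)) ∧
      seqOf D (joint m P Q) = qAdd q (seqOf D P) y := by
  have hD : Expandable D := h.expandable
  have hR := isDist_joint (by lia) hP hQ
  obtain ⟨hmem, hval⟩ := condEntropy_spec (q := q) hD h.continuous h.gen_continuous hm
    (restrict hP) fun i => restrict (hQ i i.2)
  have hjoint : ∀ (i : Fin n) (j : Fin m),
      (restrict hR).1 (finProdFinEquiv (i, j)) = P i * Q i j := fun i j => by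
    simp only [restrict, finProdFinEquiv_apply_val]
    rw [add_comm, mul_comm m]
    exact joint_apply P Q i j.2
  refine ⟨_, hmem, ?_, ?_⟩
  · rw [hval, sum_range]
    refine sum_congr rfl fun i _ => ?_
    rw [seqOf_eq hD hm (hQ i i.2), escort, seqEscort, sum_range]
    rfl
  · rw [seqOf_eq hD (by nlinarith) hR, seqOf_eq hD hn hP]
    refine h.additive n m hn hm _ _ _ (fun i => ?_) (fun i hi j => ?_)
    · simp only [hjoint]
      rw [← mul_sum, ← sum_range, (hQ i i.2).sum_eq_one, mul_one]
      rfl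
    · rw [hjoint, eq_div_iff hi, mul_comm]
      rfl

lemma Axioms.isSeqEntropy (h : Axioms q D f) (hc : Nonconstant D) :
    IsSeqEntropy q q (seqOf D) f := by
  have hD : Expandable D := h.expandable
  have hv := seqValues_seqOf hD
  refine ⟨fun {n p} hp => ?_, fun n => ?_, fun {n p} hn hp => ?_, hv ▸ h.gen_continuous,
    hv ▸ h.gen_invertible, fun hn hm hP hQ => hv ▸ h.seqOf_chain hn hm hP hQ, hv ▸ ?_⟩
  · rw [seqOf_eq hD (by lia) (hp.mono (by lia : n ≤ n + 2))]
    exact h.nonneg _ (by lia) _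
  · rw [continuousOn_iff_continuous_domRestrict]
    have heq : Set.domRestrict {p | IsDist n p} (seqOf D) =
        fun p => D (n + 2) (restrict (p.2.mono (by lia))) :=
      funext fun p => seqOf_eq hD (by lia) _
    rw [heq]
    refine (h.continuous (n + 2) (by lia)).comp (Continuous.subtype_mk ?_ _)
    exact continuous_pi fun i => (continuous_apply (i : ℕ)).comp continuous_subtype_val
  · rw [seqOf_eq hD hn hp, seqOf_eq hD hn (isDist_unif (by lia)), restrict_unif hn]
    exact h.maximal n hn _
  · obtain ⟨n, hn, P, P', hne⟩ := hc
    exact ⟨_, ⟨n, hn, P, rfl⟩, _, ⟨n, hn, P', rfl⟩, hne⟩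

end Transfer

namespace IsSeqEntropy

section Coordinates

variable {r q : ℝ} {D : (ℕ → ℝ) → ℝ} {f : ℝ → ℝ} {n m : ℕ} {P A B : ℕ → ℝ} {p : ℝ}

lemma chain_mix (h : IsSeqEntropy r q D f) (hm : 2 ≤ m) (h0 : 0 ≤ p) (h1 : p ≤ 1)
    (hA : IsDist m A) (hB : IsDist m B) :
    ∃ y ∈ seqValues D, f y = escortWeight q p * f (D A) + (1 - escortWeight q p) * f (D B) ∧
      D (mix m p A B) = qAdd r (D (binary p)) y := by
  have hAB : ∀ i < 2, IsDist m (if i = 0 then A else B) := fun i _ => by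
    split_ifs
    · exact hA
    · exact hB
  obtain ⟨y, hy, hfy, hD⟩ := h.chain le_rfl hm (isDist_binary h0 h1) hAB
  rw [sum_range_succ, sum_range_one, seqEscort_binary_zero, seqEscort_binary_one h0 h1] at hfy
  exact ⟨y, hy, hfy, by rw [← joint_binary p A hB, hD]⟩

lemma joint_const (h : IsSeqEntropy r q D f) (hm : 2 ≤ m) (hP : IsDist n P) (hB : IsDist m B) :
    D (joint m P fun _ => B) = qAdd r (D P) (D B) := by
  have hP' : IsDist (n + 2) P := hP.mono (by lia)
  obtain ⟨y, hy, hfy, hD⟩ := h.chain (by lia) hm hP' fun _ _ => hB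
  rw [← sum_mul, sum_seqEscort hP', one_mul] at hfy
  rwa [← h.gen_injOn hy ⟨m, B, hB, rfl⟩ hfy]

lemma unif_one (h : IsSeqEntropy r q D f) : D (unif 1) = 0 := by
  have hmul : ∀ x ∈ seqValues D, D (unif 1) * (1 + (1 - r) * x) = 0 := by
    rintro _ ⟨n, p, hp, rfl⟩
    have hp' : IsDist (n + 2) p := hp.mono (by lia)
    have hjoint := h.joint_const (by lia) (isDist_unif le_rfl) hp'
    rw [joint_unif_one hp', qAdd] at hjoint
    linarith
  obtain ⟨x, hx, y, hy, hxy⟩ := h.nontrivial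
  by_contra hne
  have hx' := (mul_eq_zero.1 (hmul x hx)).resolve_left hne
  have hy' := (mul_eq_zero.1 (hmul y hy)).resolve_left hne
  have hr : 1 - r ≠ 0 := fun hr => by simp [hr] at hx'
  exact hxy (mul_left_cancel₀ hr (by linarith))

lemma unif_mul (h : IsSeqEntropy r q D f) (hn : 1 ≤ n) (hm : 2 ≤ m) :
    D (unif (n * m)) = qAdd r (D (unif n)) (D (unif m)) := by
  rw [← joint_unif (by lia), h.joint_const hm (isDist_unif hn) (isDist_unif (by lia))]

lemma unif_mono (h : IsSeqEntropy r q D f) (hn : 1 ≤ n) (hnm : n ≤ m) (hm : 2 ≤ m) :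
    D (unif n) ≤ D (unif m) :=
  h.maximal hm ((isDist_unif hn).mono hnm)

lemma exists_eq (h : IsSeqEntropy r q D f) (hn : 1 ≤ n) {x : ℝ} (hx0 : 0 ≤ x)
    (hx : x ≤ D (unif n)) : ∃ p, IsDist n p ∧ D p = x :=
  (convex_setOf_isDist n).isPreconnected.intermediate_value
    ((isDist_unif le_rfl).mono hn) (isDist_unif hn) (h.continuousOn n) ⟨h.unif_one.trans_le hx0, hx⟩

lemma continuousOn_binary (h : IsSeqEntropy r q D f) :
    ContinuousOn (fun p => D (binary p)) (Set.Icc 0 1) := by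
  refine (h.continuousOn 2).comp (continuous_pi fun i => ?_).continuousOn
    fun p hp => isDist_binary hp.1 hp.2
  unfold binary
  split_ifs <;> fun_prop

lemma one_add_unif_nonneg (h : IsSeqEntropy r q D f) (hn : 2 ≤ n) :
    0 ≤ 1 + (1 - r) * D (unif n) := by
  have hD := h.nonneg (isDist_unif (by lia : 1 ≤ n))
  rcases le_or_gt r 1 with hr | hr
  · have := sub_nonneg.2 hr
    positivity
  have hmono : D (unif n) ≤ D (unif (n * n)) := h.unif_mono (by lia) (by nlinarith) (by nlinarith)
  have hsq := one_add_qAdd r (D (unif n)) (D (unif n))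
  rw [← h.unif_mul (by lia) hn] at hsq
  nlinarith

lemma binary_eq_of_one_add_unif_eq_zero (h : IsSeqEntropy r q D f) (hm : 2 ≤ m)
    (hm0 : 1 + (1 - r) * D (unif m) = 0) (hm1 : 1 + (1 - r) * D (unif (m + 1)) = 0) :
    D (binary (m / (m + 1))) = D (unif m) := by
  have hr : 1 - r ≠ 0 := fun hr => by simp [hr] at hm0
  have h0 : (0 : ℝ) ≤ m / (m + 1) := by positivity
  have h1 : (m / (m + 1) : ℝ) < 1 := (div_lt_one (by positivity)).2 (lt_add_one _)
  have hU : IsDist m (unif m) := isDist_unif (by lia)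
  have hδ : IsDist m (unif 1) := (isDist_unif le_rfl).mono (by lia)
  obtain ⟨y, -, hfy, hD⟩ := h.chain_mix hm h0 h1.le hU hδ
  have hmix := mix_unif m 1
  rw [Nat.cast_one] at hmix
  rw [hmix] at hD
  rw [hD, one_add_qAdd] at hm1
  rcases mul_eq_zero.1 hm1 with hb | hy
  · exact mul_left_cancel₀ hr (by linarith)
  · obtain rfl : y = D (unif m) := mul_left_cancel₀ hr (by linarith)
    have hf : f (D (unif m)) = f (D (unif 1)) :=
      mul_left_cancel₀ (sub_pos.2 (escortWeight_lt_one h0 h1 q)).ne' (by linarith)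
    have := h.gen_injOn ⟨m, _, hU, rfl⟩ ⟨m, _, hδ, rfl⟩ hf
    rw [this, h.unif_one, mul_zero, add_zero] at hm0
    exact absurd hm0 one_ne_zero

-- For `1 < r`, the bound could only fail if `D` were eventually constant along the uniform
-- distributions; then `binary (m / (m + 1))`, which tends to a point mass, would have that value.
lemma one_add_unif_pos (h : IsSeqEntropy r q D f) (hn : 2 ≤ n) :
    0 < 1 + (1 - r) * D (unif n) := by
  refine (h.one_add_unif_nonneg hn).lt_of_ne' fun h0 => ?_
  have hr : 1 < r := by
    by_contra! hr
    have := mul_nonneg (sub_nonneg.2 hr) (h.nonneg (isDist_unif (by lia : 1 ≤ n)))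
    linarith
  have hzero : ∀ m, n ≤ m → 1 + (1 - r) * D (unif m) = 0 := fun m hm =>
    le_antisymm (by nlinarith [h.unif_mono (by lia) hm (hn.trans hm)])
      (h.one_add_unif_nonneg (hn.trans hm))
  have hconst : ∀ m, n ≤ m → D (binary (m / (m + 1))) = D (unif n) := fun m hm => by
    rw [h.binary_eq_of_one_add_unif_eq_zero (hn.trans hm) (hzero m hm) (hzero _ (by lia))]
    exact mul_left_cancel₀ (sub_neg.2 hr).ne (by linarith [hzero m hm])
  have hlim : Tendsto (fun m : ℕ => D (binary (m / (m + 1)))) atTop (𝓝 (D (binary 1))) :=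
    (h.continuousOn_binary 1 ⟨zero_le_one, le_rfl⟩).tendsto.comp <| tendsto_nhdsWithin_iff.2
      ⟨tendsto_natCast_div_add_atTop 1, .of_forall fun m =>
        ⟨by positivity, div_le_one_of_le₀ (by linarith) (by positivity)⟩⟩
  have heq : D (unif n) = D (binary 1) := tendsto_nhds_unique
    (tendsto_const_nhds.congr' ((eventually_ge_atTop n).mono fun m hm => (hconst m hm).symm)) hlim
  rw [heq, binary_one, h.unif_one, mul_zero, add_zero] at h0
  exact one_ne_zero h0

lemma one_add_pos (h : IsSeqEntropy r q D f) {x : ℝ} (hx : x ∈ seqValues D) :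
    0 < 1 + (1 - r) * x := by
  obtain ⟨n, p, hp, rfl⟩ := hx
  have hmax : D p ≤ D (unif (n + 2)) := h.maximal (by lia) (hp.mono (by lia))
  have hpos := h.one_add_unif_pos (by lia : 2 ≤ n + 2)
  rcases le_or_gt r 1 with hr | hr
  · have := mul_nonneg (sub_nonneg.2 hr) (h.nonneg hp)
    linarith
  · nlinarith

lemma toAdd_comp (h : IsSeqEntropy r q D f) :
    IsSeqEntropy 1 q (fun p => toAdd r (D p)) (fun x => f (ofAdd r x)) := by
  have hval := seqValues_comp (toAdd r) D
  have hmem : ∀ {n p}, IsDist n p → D p ∈ seqValues D := fun hp => ⟨_, _, hp, rfl⟩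
  have hof : ∀ x ∈ seqValues D, ofAdd r (toAdd r x) = x := fun x hx =>
    ofAdd_toAdd (h.one_add_pos hx)
  refine ⟨fun hp => ?_, fun n => ?_, fun hn hp => ?_, ?_, ?_, fun {n m P Q} hn hm hP hQ => ?_, ?_⟩
  · exact toAdd_nonneg (h.one_add_pos (hmem hp)) (h.nonneg hp)
  · exact (continuousOn_toAdd r).comp (h.continuousOn n) fun p hp => h.one_add_pos (hmem hp)
  · rw [toAdd_le_toAdd_iff (h.one_add_pos (hmem hp)) (h.one_add_unif_pos hn)]
    exact h.maximal hn hp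
  · rw [hval]
    refine h.gen_continuousOn.comp (continuous_ofAdd r).continuousOn ?_
    rintro _ ⟨x, hx, rfl⟩
    rwa [hof x hx]
  · rw [hval]
    rintro _ ⟨x, hx, rfl⟩ _ ⟨y, hy, rfl⟩ hxy
    simp only [hof x hx, hof y hy] at hxy
    rw [h.gen_injOn hx hy hxy]
  · obtain ⟨y, hy, hfy, hD⟩ := h.chain hn hm hP hQ
    refine ⟨toAdd r y, hval ▸ Set.mem_image_of_mem _ hy, ?_, ?_⟩
    · rw [hof y hy, hfy]
      exact sum_congr rfl fun i hi => by rw [hof _ (hmem (hQ i (mem_range.1 hi)))]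
    · rw [hD, toAdd_qAdd (h.one_add_pos (hmem hP)) (h.one_add_pos hy), qAdd_one]
  · rw [hval]
    exact h.nontrivial.image_of_injOn (Set.LeftInvOn.injOn hof)

end Coordinates

section Additive

variable {q : ℝ} {H : (ℕ → ℝ) → ℝ} {F : ℝ → ℝ} {n m : ℕ}

lemma unif_pow (h : IsSeqEntropy 1 q H F) (hn : 2 ≤ n) (k : ℕ) :
    H (unif (n ^ k)) = k * H (unif n) := by
  induction k with
  | zero => simp [h.unif_one]
  | succ k ih =>
    rw [pow_succ, h.unif_mul (Nat.one_le_pow _ _ (by lia)) hn, qAdd_one, ih]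
    push_cast
    ring

lemma unif_two_pos (h : IsSeqEntropy 1 q H F) : 0 < H (unif 2) := by
  refine (h.nonneg (isDist_unif one_le_two)).lt_of_ne' fun h0 => ?_
  have hzero : ∀ x ∈ seqValues H, x = 0 := by
    rintro _ ⟨n, p, hp, rfl⟩
    have hlt : n < 2 ^ n := n.lt_two_pow_self
    have hle : H p ≤ H (unif (2 ^ n)) :=
      h.maximal ((Nat.succ_le_of_lt hp.pos).trans_lt hlt) (hp.mono hlt.le)
    rw [h.unif_pow le_rfl, h0, mul_zero] at hle
    exact le_antisymm hle (h.nonneg hp)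
  obtain ⟨x, hx, y, hy, hxy⟩ := h.nontrivial
  exact hxy ((hzero x hx).trans (hzero y hy).symm)

lemma exists_isDist_eq (h : IsSeqEntropy 1 q H F) {x : ℝ} (hx : 0 ≤ x) :
    ∃ n p, 2 ≤ n ∧ IsDist n p ∧ H p = x := by
  obtain ⟨k, hk⟩ := exists_nat_ge (x / H (unif 2))
  rw [div_le_iff₀ h.unif_two_pos, ← h.unif_pow le_rfl] at hk
  obtain ⟨p, hp, hHp⟩ := h.exists_eq Nat.one_le_two_pow hx hk
  exact ⟨2 ^ k + 2, p, by lia, hp.mono (by lia), hHp⟩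

lemma seqValues_eq (h : IsSeqEntropy 1 q H F) : seqValues H = Set.Ici 0 := by
  refine Set.Subset.antisymm ?_ fun x hx => ?_
  · rintro _ ⟨n, p, hp, rfl⟩
    exact h.nonneg hp
  · obtain ⟨n, p, -, hp, hHp⟩ := h.exists_isDist_eq hx
    exact ⟨n, p, hp, hHp⟩

lemma translativeMeans (h : IsSeqEntropy 1 q H F) (hq : 0 < q) : TranslativeMeans F := by
  intro x y z t w hx hy hz ht hw hFz
  obtain ⟨a, A, ha, hA, rfl⟩ := h.exists_isDist_eq hx
  obtain ⟨b, B, -, hB, rfl⟩ := h.exists_isDist_eq hy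
  obtain ⟨k, T, hk, hT, rfl⟩ := h.exists_isDist_eq ht
  obtain ⟨p, ⟨hp0, hp1⟩, rfl⟩ := exists_escortWeight_eq hq hw
  replace hA : IsDist (a + b) A := hA.mono (by lia)
  replace hB : IsDist (a + b) B := hB.mono (by lia)
  obtain ⟨y₁, hy₁, hFy₁, hmix⟩ := h.chain_mix (ha.trans (by lia)) hp0 hp1 hA hB
  rw [← hFz] at hFy₁
  rw [h.gen_injOn hy₁ (h.seqValues_eq ▸ hz) hFy₁, qAdd_one] at hmix
  obtain ⟨y₂, -, hFy₂, hjoint⟩ := h.chain_mix (by nlinarith) hp0 hp1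
    (isDist_joint (by lia) hA fun _ _ => hT) (isDist_joint (by lia) hB fun _ _ => hT)
  rw [h.joint_const hk hA hT, h.joint_const hk hB hT] at hFy₂
  rw [← joint_mix (by lia), h.joint_const hk (isDist_mix hp0 hp1 hA hB) hT, hmix] at hjoint
  simp only [qAdd_one] at hFy₂ hjoint
  rw [← hFy₂]
  congr 1
  linarith

-- Splitting the first two points of `(1/4, 1/4, 1/2, 0)` into halves gives a distribution that
-- also arises in one step from `(1/2, 1/2)`; `v + w` and its given value are the entropies that
-- the two ways of computing add to `H (unif 2)`.
lemma exists_dyadic (h : IsSeqEntropy 1 q H F) (hq : q ≠ 0) :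
    ∃ v w, 0 ≤ v ∧ 0 ≤ w ∧ F v = (F (H (unif 2)) + F 0) / 2 ∧
      F w = (2 * F (H (unif 2)) + 2 ^ q * F 0) / (2 + 2 ^ q) ∧
      F (v + w) = (F (2 * H (unif 2)) + F 0) / 2 := by
  have hmem : ∀ y ∈ seqValues H, 0 ≤ y := fun y hy => by rwa [h.seqValues_eq] at hy
  have h0 : (0 : ℝ) ≤ 1 / 2 := by norm_num
  have h1 : (1 / 2 : ℝ) ≤ 1 := by norm_num
  have hδ : ∀ n, 1 ≤ n → IsDist n (unif 1) := fun n hn => (isDist_unif le_rfl).mono hn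
  have hU2 : IsDist 2 (unif 2) := isDist_unif one_le_two
  have hT : ∀ i < 4, IsDist 2 (if i < 2 then unif 2 else unif 1) := fun i _ => by
    split_ifs
    · exact hU2
    · exact hδ 2 one_le_two
  obtain ⟨v, hv, hFv, hHv⟩ := h.chain_mix le_rfl h0 h1 hU2 (hδ 2 one_le_two)
  obtain ⟨w, hw, hFw, hHw⟩ :=
    h.chain (by lia) le_rfl (isDist_mix h0 h1 hU2 (hδ 2 one_le_two)) hT
  obtain ⟨u, -, hFu, hHu⟩ :=
    h.chain_mix (by lia) h0 h1 (isDist_unif (by lia : 1 ≤ 4)) (hδ 4 (by lia))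
  have hsum : u = v + w := by
    rw [joint_mix_half_unif_two, hHu, hHv] at hHw
    simp only [qAdd_one] at hHw
    linarith
  have hU4 : H (unif 4) = 2 * H (unif 2) := by simpa using h.unif_pow le_rfl 2
  rw [escortWeight_half, h.unif_one] at hFv hFu
  simp only [apply_ite H, apply_ite F, h.unif_one, sum_seqEscort_mix_half_unif_two hq] at hFw
  refine ⟨v, w, hmem v hv, hmem w hw, by linarith, hFw, ?_⟩
  rw [← hsum, hFu, hU4]
  ring

lemma exponent_eq (h : IsSeqEntropy 1 q H F) (hq : q ≠ 0) {s c b : ℝ} (hc : c ≠ 0)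
    (hF : ∀ x, 0 ≤ x → F x = ofAdd s (c * x) + b) :
    (1 - s) * (c * H (unif 2)) = (1 - q) * Real.log 2 := by
  obtain ⟨v, w, hv, hw, hFv, hFw, hFvw⟩ := h.exists_dyadic hq
  have hL := h.unif_two_pos
  have hpow : (0 : ℝ) < 2 ^ q := by positivity
  set L := H (unif 2)
  set g := ofAdd s (c * L) with hg
  have hg0 : g ≠ 0 := fun h0 => mul_ne_zero hc hL.ne' <|
    (ofAdd_strictMono s).injective (h0.trans (ofAdd_zero s).symm)
  have hF0 : F 0 = b := by rw [hF 0 le_rfl, mul_zero, ofAdd_zero, zero_add]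
  have hgv : ofAdd s (c * v) = g / 2 := by
    rw [hF v hv, hF L hL.le, hF0] at hFv
    linarith
  have hgw : ofAdd s (c * w) = 2 * g / (2 + 2 ^ q) := by
    rw [hF w hw, hF L hL.le, hF0] at hFw
    rw [eq_div_iff (by positivity)] at hFw ⊢
    linarith
  have hgvw : qAdd s (g / 2) (2 * g / (2 + 2 ^ q)) = qAdd s g g / 2 := by
    rw [← hgv, ← hgw, hg, ← ofAdd_add, ← ofAdd_add, ← mul_add, ← mul_add, ← two_mul]
    rw [hF _ (add_nonneg hv hw), hF _ (by positivity), hF0] at hFvw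
    linarith
  have hexp : 2 ^ q * Real.exp ((1 - s) * (c * L)) = 2 := by
    rw [← one_add_ofAdd, ← hg]
    rw [qAdd, qAdd] at hgvw
    field_simp at hgvw
    linear_combination -hgvw
  have hlog := congrArg Real.log hexp
  rw [Real.log_mul hpow.ne' (Real.exp_pos _).ne', Real.log_rpow two_pos, Real.log_exp] at hlog
  linarith

lemma exists_gen_eq (h : IsSeqEntropy 1 q H F) (hq : 0 < q) :
    ∃ s c b, c ≠ 0 ∧ (1 - s) * (c * H (unif 2)) = (1 - q) * Real.log 2 ∧
      ∀ x, 0 ≤ x → F x = ofAdd s (c * x) + b := by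
  have hval := h.seqValues_eq
  obtain ⟨s, c, b, hc, hF⟩ := (h.translativeMeans hq).exists_eq_ofAdd_add
    (hval ▸ h.gen_continuousOn) (hval ▸ h.gen_injOn)
  exact ⟨s, c, b, hc, h.exponent_eq hq.ne' hc hF, hF⟩

end Additive

section Uniqueness

variable {q : ℝ} {H H' : (ℕ → ℝ) → ℝ} {F : ℝ → ℝ} {n m : ℕ} {P A B : ℕ → ℝ} {p : ℝ}

lemma unif_mem_Icc (h : IsSeqEntropy 1 q H F) (hn : 2 ≤ n) :
    H (unif n) ∈ Set.Icc (Nat.log 2 n * H (unif 2)) ((Nat.log 2 n + 1) * H (unif 2)) := by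
  constructor
  · rw [← h.unif_pow le_rfl]
    exact h.unif_mono Nat.one_le_two_pow (Nat.pow_log_le_self 2 (by lia)) hn
  · have hlt : n < 2 ^ (Nat.log 2 n + 1) := Nat.lt_pow_succ_log_self one_lt_two n
    rw [← Nat.cast_succ, ← h.unif_pow le_rfl]
    exact h.unif_mono (by lia) hlt.le (hn.trans hlt.le)

lemma unif_eq (h : IsSeqEntropy 1 q H F) (h' : IsSeqEntropy 1 q H' F)
    (h2 : H (unif 2) = H' (unif 2)) (hn : 1 ≤ n) : H (unif n) = H' (unif n) := by
  rcases hn.eq_or_lt with rfl | hn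
  · rw [h.unif_one, h'.unif_one]
  have hbound : ∀ k : ℕ, k ≠ 0 → k * |H (unif n) - H' (unif n)| ≤ H (unif 2) := fun k hk => by
    have hnk : 2 ≤ n ^ k := hn.trans_le (Nat.le_self_pow hk n)
    obtain ⟨hl, hu⟩ := h.unif_mem_Icc hnk
    obtain ⟨hl', hu'⟩ := h'.unif_mem_Icc hnk
    rw [h.unif_pow hn] at hl hu
    rw [h'.unif_pow hn, ← h2] at hl' hu'
    rw [← Nat.abs_cast, ← abs_mul, abs_le]
    constructor <;> linarith
  by_contra hne
  have hpos : 0 < |H (unif n) - H' (unif n)| := abs_pos.2 (sub_ne_zero.2 hne)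
  obtain ⟨k, hk⟩ := exists_nat_gt (H (unif 2) / |H (unif n) - H' (unif n)|)
  have hk0 : k ≠ 0 := fun h0 => by
    rw [h0, Nat.cast_zero] at hk
    exact hk.not_ge (div_nonneg h.unif_two_pos.le hpos.le)
  exact (hbound k hk0).not_gt ((div_lt_iff₀ hpos).1 hk)

lemma mix_sub_mix (h : IsSeqEntropy 1 q H F) (h' : IsSeqEntropy 1 q H' F) (hm : 2 ≤ m)
    (h0 : 0 ≤ p) (h1 : p ≤ 1) (hA : IsDist m A) (hB : IsDist m B) (hAA : H A = H' A)
    (hBB : H B = H' B) :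
    H (mix m p A B) - H' (mix m p A B) = H (binary p) - H' (binary p) := by
  obtain ⟨y, hy, hFy, hH⟩ := h.chain_mix hm h0 h1 hA hB
  obtain ⟨y', hy', hFy', hH'⟩ := h'.chain_mix hm h0 h1 hA hB
  rw [h'.seqValues_eq, ← h.seqValues_eq] at hy'
  have hyy : y = y' := h.gen_injOn hy hy' (by rw [hFy, hFy', hAA, hBB])
  rw [hH, hH', hyy, qAdd_one, qAdd_one, add_sub_add_right_eq_sub]

lemma binary_div_eq (h : IsSeqEntropy 1 q H F) (h' : IsSeqEntropy 1 q H' F)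
    (h2 : H (unif 2) = H' (unif 2)) (hm : 2 ≤ m) (hnm : n ≤ m) :
    H (binary (m / (m + n))) = H' (binary (m / (m + n))) := by
  rcases Nat.eq_zero_or_pos n with rfl | hn
  · rw [Nat.cast_zero, add_zero, div_self (by positivity), binary_one, h.unif_one, h'.unif_one]
  · have hsub := h.mix_sub_mix h' hm (p := m / (m + n)) (by positivity)
      (div_le_one_of_le₀ (le_add_of_nonneg_right (Nat.cast_nonneg n)) (by positivity))
      (isDist_unif (by lia)) ((isDist_unif hn).mono hnm)
      (h.unif_eq h' h2 (by lia)) (h.unif_eq h' h2 hn)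
    rwa [mix_unif, h.unif_eq h' h2 (by lia), sub_self, eq_comm, sub_eq_zero] at hsub

lemma binary_eq (h : IsSeqEntropy 1 q H F) (h' : IsSeqEntropy 1 q H' F)
    (h2 : H (unif 2) = H' (unif 2)) (h0 : 1 / 2 ≤ p) (h1 : p ≤ 1) :
    H (binary p) = H' (binary p) := by
  have hle : ∀ k : ℕ, ⌈p * k⌉₊ ≤ k := fun k =>
    Nat.ceil_le.2 (mul_le_of_le_one_left k.cast_nonneg h1)
  have heq : ∀ k : ℕ, 3 ≤ k → H (binary (⌈p * k⌉₊ / k)) = H' (binary (⌈p * k⌉₊ / k)) :=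
    fun k hk => by
      have hhalf : k ≤ 2 * ⌈p * k⌉₊ := by
        have := Nat.le_ceil (p * k)
        have : (k : ℝ) ≤ 2 * ⌈p * k⌉₊ := by nlinarith [k.cast_nonneg (α := ℝ)]
        exact_mod_cast this
      have := h.binary_div_eq h' h2 (m := ⌈p * k⌉₊) (n := k - ⌈p * k⌉₊) (by lia) (by lia)
      rwa [← Nat.cast_add, Nat.add_sub_cancel' (hle k)] at this
  have hlim : Tendsto (fun k : ℕ => (⌈p * k⌉₊ / k : ℝ)) atTop (𝓝[Set.Icc 0 1] p) :=
    tendsto_nhdsWithin_iff.2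
      ⟨(tendsto_nat_ceil_mul_div_atTop (by linarith)).comp tendsto_natCast_atTop_atTop,
        .of_forall fun k => ⟨by positivity,
          div_le_one_of_le₀ (Nat.cast_le.2 (hle k)) (Nat.cast_nonneg k)⟩⟩
  have hp : p ∈ Set.Icc (0 : ℝ) 1 := ⟨by linarith, h1⟩
  refine tendsto_nhds_unique ((h.continuousOn_binary p hp).tendsto.comp hlim)
    (((h'.continuousOn_binary p hp).tendsto.comp hlim).congr' ?_)
  filter_upwards [eventually_ge_atTop 3] with k hk
  exact (heq k hk).symm

lemma eq_of_half_le (h : IsSeqEntropy 1 q H F) (h' : IsSeqEntropy 1 q H' F)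
    (h2 : H (unif 2) = H' (unif 2)) (hn : 2 ≤ n) (hP : IsDist n P) (h0 : 1 / 2 ≤ P 0) :
    H P = H' P := by
  induction n, hn using Nat.le_induction generalizing P with
  | base =>
    rw [hP.eq_binary]
    exact h.binary_eq h' h2 h0 (hP.le_one 0)
  | succ n hn ih =>
    have hlast : P n ≤ 1 / 2 := by
      have hsum := hP.sum_eq_one
      have hle := single_le_sum (fun i _ => hP.nonneg i) (mem_range.2 (by lia : 0 < n))
      rw [sum_range_succ] at hsum
      linarith
    obtain ⟨A, hA, hmix⟩ := hP.exists_eq_mix (by linarith)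
    have hA0 : 1 / 2 ≤ A 0 := by
      rw [hmix, mix_of_lt _ _ _ (by lia)] at h0
      nlinarith [hP.nonneg n, hA.nonneg 0]
    have hsub := h.mix_sub_mix h' (p := 1 - P n) hn (by linarith) (by linarith [hP.nonneg n]) hA
      ((isDist_unif le_rfl).mono (by lia)) (ih hA hA0) (by rw [h.unif_one, h'.unif_one])
    rw [h.binary_eq h' h2 (by linarith) (by linarith [hP.nonneg n]), sub_self, sub_eq_zero] at hsub
    rw [hmix, hsub]

lemma eq_of_unif_two_eq (h : IsSeqEntropy 1 q H F) (h' : IsSeqEntropy 1 q H' F)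
    (h2 : H (unif 2) = H' (unif 2)) (hP : IsDist n P) : H P = H' P := by
  have h0 : (0 : ℝ) ≤ 1 / 2 := by norm_num
  have h1 : (1 / 2 : ℝ) ≤ 1 := by norm_num
  have hδ : IsDist (n + 2) (unif 1) := (isDist_unif le_rfl).mono (by lia)
  have hP' : IsDist (n + 2) P := hP.mono (by lia)
  obtain ⟨y, -, hFy, hH⟩ := h.chain_mix (by lia) h0 h1 hδ hP'
  obtain ⟨y', -, hFy', hH'⟩ := h'.chain_mix (by lia) h0 h1 hδ hP'
  have hmix := h.eq_of_half_le h' h2 (by lia) (isDist_mix h0 h1 hδ hP')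
    (by rw [mix_of_lt _ _ _ (by lia), unif_of_lt one_pos]; norm_num)
  rw [hH, hH', binary_half, h2, qAdd_one, qAdd_one, add_right_inj] at hmix
  rw [← hmix, hFy, h.unif_one, h'.unif_one, escortWeight_half] at hFy'
  exact h.gen_injOn ⟨_, P, hP, rfl⟩ (h.seqValues_eq ▸ h'.nonneg hP) (by linarith)

end Uniqueness

end IsSeqEntropy

section Tsallis

/-- The summand `(x ^ q - x) / (1 - q)` of the Tsallis entropy. At `q = 1` it is `-x log₂ x`, which
is the limit only up to the factor `log 2`: the family `entropy` has the same jump. -/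
noncomputable def tsallisTerm (q x : ℝ) : ℝ :=
  if q = 1 then Real.negMulLog x / Real.log 2 else (x ^ q - x) / (1 - q)

/-- The Tsallis entropy, or the Shannon entropy in bits if `q = 1`. -/
noncomputable def tsallis (q : ℝ) {n : ℕ} (P : Δ n) : ℝ := ∑ k, tsallisTerm q (P.1 k)

variable {q x y : ℝ} {n m : ℕ}

lemma tsallisTerm_of_ne_one (hq : q ≠ 1) (x : ℝ) : tsallisTerm q x = (x ^ q - x) / (1 - q) :=
  if_neg hq

lemma tsallisTerm_one_left (x : ℝ) : tsallisTerm 1 x = Real.negMulLog x / Real.log 2 := if_pos rfl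

lemma tsallisTerm_zero (hq : q ≠ 0) : tsallisTerm q 0 = 0 := by
  simp [tsallisTerm, Real.zero_rpow hq]

lemma tsallisTerm_one (q : ℝ) : tsallisTerm q 1 = 0 := by simp [tsallisTerm]

lemma continuous_tsallisTerm (hq : 0 < q) : Continuous (tsallisTerm q) := by
  rcases eq_or_ne q 1 with rfl | hq1
  · exact (Real.continuous_negMulLog.div_const _).congr fun x => (tsallisTerm_one_left x).symm
  · exact (((Real.continuous_rpow_const hq.le).sub continuous_id).div_const _).congr fun x =>
      (tsallisTerm_of_ne_one hq1 x).symm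

lemma concaveOn_tsallisTerm (hq : 0 ≤ q) : ConcaveOn ℝ (Set.Ici 0) (tsallisTerm q) := by
  rcases lt_trichotomy q 1 with hq1 | rfl | hq1
  · refine (((Real.concaveOn_rpow hq hq1.le).sub (convexOn_id (convex_Ici 0))).smul
      (inv_nonneg.2 (sub_nonneg.2 hq1.le))).congr fun x _ => ?_
    rw [tsallisTerm_of_ne_one hq1.ne, div_eq_inv_mul]
    rfl
  · refine (Real.concaveOn_negMulLog.smul
      (inv_nonneg.2 (Real.log_nonneg one_le_two))).congr fun x _ => ?_
    rw [tsallisTerm_one_left, div_eq_inv_mul]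
    rfl
  · refine (((convexOn_rpow hq1.le).sub (concaveOn_id (convex_Ici 0))).neg.smul
      (inv_nonneg.2 (sub_nonneg.2 hq1.le))).congr fun x _ => ?_
    rw [tsallisTerm_of_ne_one hq1.ne', ← neg_div_neg_eq, neg_sub 1, div_eq_inv_mul]
    rfl

lemma tsallisTerm_nonneg (hq : 0 < q) (h0 : 0 ≤ x) (h1 : x ≤ 1) : 0 ≤ tsallisTerm q x := by
  have hmin := (concaveOn_tsallisTerm hq.le).min_le_of_mem_Icc Set.self_mem_Ici
    (Set.mem_Ici.2 zero_le_one) ⟨h0, h1⟩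
  rwa [tsallisTerm_zero hq.ne', tsallisTerm_one, min_self] at hmin

lemma tsallisTerm_mul (hx : 0 ≤ x) (hy : 0 ≤ y) :
    tsallisTerm q (x * y) = y * tsallisTerm q x + x ^ q * tsallisTerm q y := by
  rcases eq_or_ne q 1 with rfl | hq1
  · simp only [tsallisTerm_one_left, Real.negMulLog_mul, Real.rpow_one]
    ring
  · simp only [tsallisTerm_of_ne_one hq1, Real.mul_rpow hx hy]
    ring

lemma one_add_tsallis (q : ℝ) (P : Δ n) : 1 + (1 - q) * tsallis q P = ∑ k, P.1 k ^ q := by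
  rcases eq_or_ne q 1 with rfl | hq1
  · simp [P.2.2]
  · simp only [tsallis, tsallisTerm_of_ne_one hq1]
    rw [← sum_div, sum_sub_distrib, P.2.2,
      mul_div_cancel₀ _ (sub_ne_zero.2 hq1.symm), add_sub_cancel]

lemma one_add_tsallis_pos (q : ℝ) (P : Δ n) : 0 < 1 + (1 - q) * tsallis q P :=
  one_add_tsallis q P ▸ sum_rpow_pos P q

lemma tsallis_nonneg (hq : 0 < q) (P : Δ n) : 0 ≤ tsallis q P :=
  sum_nonneg fun k _ => tsallisTerm_nonneg hq (P.2.1 k) (stdSimplex.le_one P k)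

lemma continuous_tsallis (hq : 0 < q) (n : ℕ) : Continuous fun P : Δ n => tsallis q P :=
  continuous_finsetSum _ fun k _ =>
    (continuous_tsallisTerm hq).comp ((continuous_apply k).comp continuous_subtype_val)

lemma tsallis_le_uniform (hq : 0 ≤ q) (hn : 2 ≤ n) (P : Δ n) :
    tsallis q P ≤ tsallis q (uniform n hn) := by
  have hn0 : (0 : ℝ) < n := by positivity
  have hjensen := (concaveOn_tsallisTerm hq).le_map_sum (t := univ) (w := fun _ => 1 / (n : ℝ))
    (p := P.1) (fun _ _ => by positivity) (by simp [hn0.ne']) fun k _ => P.2.1 k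
  simp only [smul_eq_mul, ← mul_sum, P.2.2, mul_one] at hjensen
  rw [one_div, inv_mul_le_iff₀ hn0] at hjensen
  simpa [tsallis, uniform] using hjensen

lemma tsallis_expand (hq : q ≠ 0) (P : Δ n) : tsallis q (expand P) = tsallis q P := by
  simp [tsallis, expand, Fin.sum_univ_castSucc, tsallisTerm_zero hq]

lemma tsallis_joint {R : Δ (n * m)} {P : Δ n} {Q : Fin n → Δ m}
    (hR : ∀ i j, R.1 (finProdFinEquiv (i, j)) = P.1 i * (Q i).1 j) :
    tsallis q R = qAdd q (tsallis q P) (∑ i, escort q P i * tsallis q (Q i)) := by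
  have hescort : ∀ i, (∑ k, P.1 k ^ q) * escort q P i = P.1 i ^ q := fun i =>
    mul_div_cancel₀ _ (sum_rpow_pos P q).ne'
  calc tsallis q R
    _ = ∑ i, ∑ j, tsallisTerm q (P.1 i * (Q i).1 j) := by
      simp only [tsallis, ← hR, ← finProdFinEquiv.sum_comp, Fintype.sum_prod_type]
    _ = ∑ i, (tsallisTerm q (P.1 i) + P.1 i ^ q * tsallis q (Q i)) := by
      refine sum_congr rfl fun i _ => ?_
      simp only [tsallisTerm_mul (P.2.1 i) ((Q i).2.1 _)]
      rw [sum_add_distrib, ← sum_mul, (Q i).2.2, one_mul, ← mul_sum, tsallis]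
    _ = tsallis q P + (1 + (1 - q) * tsallis q P) * ∑ i, escort q P i * tsallis q (Q i) := by
      rw [one_add_tsallis, sum_add_distrib, mul_sum, tsallis]
      simp only [← mul_assoc, hescort]
    _ = _ := by
      rw [qAdd]
      ring

lemma toAdd_tsallis_uniform_two (q : ℝ) :
    toAdd q (tsallis q (uniform 2 le_rfl)) = if q = 1 then 1 else Real.log 2 := by
  rcases eq_or_ne q 1 with rfl | hq1
  · have := (Real.log_pos one_lt_two).ne'
    simp [tsallis, tsallisTerm, uniform, Real.negMulLog]
    field_simp
  · have hpow : ∑ k, (uniform 2 le_rfl).1 k ^ q = 2 ^ (1 - q) := by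
      simp [uniform, Real.inv_rpow, Real.rpow_sub, div_eq_mul_inv]
    rw [toAdd, if_neg hq1, if_neg hq1, one_add_tsallis, hpow, Real.log_rpow two_pos,
      mul_div_cancel_left₀ _ (sub_ne_zero.2 hq1.symm)]

lemma toAdd_tsallis_uniform_two_pos (q : ℝ) : 0 < toAdd q (tsallis q (uniform 2 le_rfl)) := by
  rw [toAdd_tsallis_uniform_two]
  split_ifs
  · exact one_pos
  · exact Real.log_pos one_lt_two

lemma one_sub_mul_toAdd_tsallis_uniform_two (q : ℝ) :
    (1 - q) * toAdd q (tsallis q (uniform 2 le_rfl)) = (1 - q) * Real.log 2 := by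
  rw [toAdd_tsallis_uniform_two]
  split_ifs with hq
  · rw [hq, sub_self, zero_mul, zero_mul]
  · rfl

end Tsallis

section Entropy

variable {q τ : ℝ} {D : (n : ℕ) → Δ n → ℝ} {f : ℝ → ℝ} {n m : ℕ}

lemma entropy_eq_qSmul_tsallis (q τ : ℝ) (P : Δ n) :
    entropy q τ P = qSmul q (-τ) (tsallis q P) := by
  rcases eq_or_ne q 1 with rfl | hq1
  · simp only [entropy, qSmul, if_pos, ofAdd_one, toAdd_one, tsallis, tsallisTerm, Real.logb,
      Real.negMulLog, mul_sum]
    exact sum_congr rfl fun k _ => by ring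
  · have hpow := one_add_qSmul (one_add_tsallis_pos q P) (-τ)
    rw [one_add_tsallis] at hpow
    rw [entropy, if_neg hq1, ← hpow, add_sub_cancel_left, one_div,
      inv_mul_cancel_left₀ (sub_ne_zero.2 hq1.symm)]

lemma exists_generator_eq_qSmul (q : ℝ) (hτ : τ ≠ 0) : ∃ a b : ℝ, a ≠ 0 ∧
    ∀ x, 0 < 1 + (1 - q) * x → generator q τ x = a * qSmul q (-1 / τ) x + b := by
  rcases eq_or_ne q 1 with rfl | hq1
  · refine ⟨-(τ * τ), 0, neg_ne_zero.2 (mul_ne_zero hτ hτ), fun x _ => ?_⟩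
    simp only [generator, qSmul, if_pos, ofAdd_one, toAdd_one]
    field_simp
    ring
  · refine ⟨1 - q, 1, sub_ne_zero.2 hq1.symm, fun x hx => ?_⟩
    rw [generator, if_neg hq1, add_comm, ← one_add_qSmul hx, add_comm]

lemma affine_generator_iff (hτ : τ ≠ 0) {S : Set ℝ} (hS : ∀ x ∈ S, 0 < 1 + (1 - q) * x) :
    (∃ a b : ℝ, a ≠ 0 ∧ ∀ x ∈ S, f x = a * generator q τ x + b) ↔
      ∃ a b : ℝ, a ≠ 0 ∧ ∀ x ∈ S, f x = a * qSmul q (-1 / τ) x + b := by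
  obtain ⟨a', b', ha', hgen⟩ := exists_generator_eq_qSmul q hτ
  constructor
  · rintro ⟨a, b, ha, hf⟩
    refine ⟨a * a', a * b' + b, mul_ne_zero ha ha', fun x hx => ?_⟩
    rw [hf x hx, hgen x (hS x hx)]
    ring
  · rintro ⟨a, b, ha, hf⟩
    refine ⟨a / a', b - a / a' * b', div_ne_zero ha ha', fun x hx => ?_⟩
    rw [hf x hx, hgen x (hS x hx)]
    field_simp
    ring

/-- The family `D` is the entropy with parameters `q` and `τ`. -/
def IsEntropy (q τ : ℝ) (D : (n : ℕ) → Δ n → ℝ) : Prop :=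
  ∀ n, 2 ≤ n → ∀ P : Δ n, D n P = entropy q τ P

namespace IsEntropy

lemma eq_qSmul_tsallis (hD : IsEntropy q τ D) (hn : 2 ≤ n) (P : Δ n) :
    D n P = qSmul q (-τ) (tsallis q P) := by
  rw [hD n hn, entropy_eq_qSmul_tsallis]

lemma one_add_pos (hD : IsEntropy q τ D) {x : ℝ} (hx : x ∈ values D) : 0 < 1 + (1 - q) * x := by
  obtain ⟨n, hn, P, rfl⟩ := hx
  rw [hD.eq_qSmul_tsallis hn]
  exact one_add_qSmul_pos _ _ _

lemma nonneg (hD : IsEntropy q τ D) (hq : 0 < q) (hτ : τ ≤ 0) (hn : 2 ≤ n) (P : Δ n) :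
    0 ≤ D n P := by
  rw [hD.eq_qSmul_tsallis hn, ← qSmul_zero q (-τ)]
  exact qSmul_le_qSmul (neg_nonneg.2 hτ) (by simp) (one_add_tsallis_pos q P) (tsallis_nonneg hq P)

lemma continuous (hD : IsEntropy q τ D) (hq : 0 < q) (hn : 2 ≤ n) : Continuous (D n) := by
  rw [funext (hD.eq_qSmul_tsallis hn)]
  exact (continuousOn_qSmul q (-τ)).comp_continuous (continuous_tsallis hq n)
    (one_add_tsallis_pos q)

lemma expandable (hD : IsEntropy q τ D) (hq : q ≠ 0) : Expandable D := fun n hn P => by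
  rw [hD.eq_qSmul_tsallis hn, hD.eq_qSmul_tsallis (by lia), tsallis_expand hq]

lemma qSmul_eq_tsallis (hD : IsEntropy q τ D) (hτ : τ ≠ 0) (hn : 2 ≤ n) (P : Δ n) :
    qSmul q (-1 / τ) (D n P) = tsallis q P := by
  rw [hD.eq_qSmul_tsallis hn, qSmul_qSmul, div_mul_eq_mul_div, neg_one_mul, neg_neg, div_self hτ,
    qSmul_one (one_add_tsallis_pos q P)]

lemma qSmul_qSmul_cancel (hD : IsEntropy q τ D) (hτ : τ ≠ 0) {x : ℝ} (hx : x ∈ values D) :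
    qSmul q (-τ) (qSmul q (-1 / τ) x) = x := by
  obtain ⟨n, hn, P, rfl⟩ := hx
  rw [hD.qSmul_eq_tsallis hτ hn, hD.eq_qSmul_tsallis hn]

lemma qAdd_condEntropy (hD : IsEntropy q τ D) (hq : 0 < q) (hτ : τ ≠ 0)
    (hf : ContinuousOn f (values D)) {a b : ℝ} (ha : a ≠ 0)
    (hfab : ∀ x ∈ values D, f x = a * qSmul q (-1 / τ) x + b) (hn : 2 ≤ n) (hm : 2 ≤ m) (P : Δ n)
    (Q : Fin n → Δ m) : qAdd q (D n P) (condEntropy q D f P Q) =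
      qSmul q (-τ) (qAdd q (tsallis q P) (∑ i, escort q P i * tsallis q (Q i))) := by
  obtain ⟨hmem, hval⟩ := condEntropy_spec (q := q) (hD.expandable hq.ne')
    (fun n hn => hD.continuous hq hn) hf hm P Q
  have hmean : qSmul q (-1 / τ) (condEntropy q D f P Q) =
      ∑ i, escort q P i * tsallis q (Q i) := by
    refine mul_left_cancel₀ ha (add_right_cancel (b := b) ?_)
    calc a * qSmul q (-1 / τ) (condEntropy q D f P Q) + b
      _ = ∑ i, escort q P i * (a * tsallis q (Q i) + b) := by
        rw [← hfab _ hmem, hval]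
        refine sum_congr rfl fun i _ => ?_
        rw [hfab _ ⟨m, hm, Q i, rfl⟩, hD.qSmul_eq_tsallis hτ hm]
      _ = a * ∑ i, escort q P i * tsallis q (Q i) + b := by
        simp only [mul_add, sum_add_distrib, ← sum_mul, sum_escort, one_mul, mul_sum,
          mul_left_comm a]
  rw [← hmean, qSmul_qAdd (one_add_tsallis_pos q P) (one_add_qSmul_pos _ _ _),
    hD.qSmul_qSmul_cancel hτ hmem, hD.eq_qSmul_tsallis hn]

theorem axioms (hD : IsEntropy q τ D) (hq : 0 < q) (hτ : τ < 0)
    (hf : ∃ a b : ℝ, a ≠ 0 ∧ ∀ x ∈ values D, f x = a * generator q τ x + b) : Axioms q D f := by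
  obtain ⟨a, b, ha, hfab⟩ := (affine_generator_iff hτ.ne fun x => hD.one_add_pos).1 hf
  have hcont : ContinuousOn f (values D) :=
    ((((continuousOn_qSmul q (-1 / τ)).mono fun x => hD.one_add_pos).const_mul a).add_const b).congr
      hfab
  refine ⟨fun n hn => hD.nonneg hq hτ.le hn, fun n hn => hD.continuous hq hn, fun n hn P => ?_,
    hD.expandable hq.ne', hcont, fun x hx y hy hxy => ?_, fun n m hn hm R P Q hP hQ => ?_⟩
  · rw [hD.eq_qSmul_tsallis hn, hD.eq_qSmul_tsallis hn]
    exact qSmul_le_qSmul (neg_nonneg.2 hτ.le) (one_add_tsallis_pos q _) (one_add_tsallis_pos q _)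
      (tsallis_le_uniform hq.le hn P)
  · rw [hfab x hx, hfab y hy, add_left_inj, mul_right_inj' ha] at hxy
    rw [← hD.qSmul_qSmul_cancel hτ.ne hx, hxy, hD.qSmul_qSmul_cancel hτ.ne hy]
  · have hR : ∀ i j, R.1 (finProdFinEquiv (i, j)) = P.1 i * (Q i).1 j := fun i j => by
      by_cases hi : P.1 i = 0
      · rw [hi, zero_mul]
        exact (sum_eq_zero_iff_of_nonneg fun j _ => R.2.1 _).1 ((hP i).symm.trans hi) j (mem_univ j)
      · rw [hQ i hi j, mul_div_cancel₀ _ hi]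
    rw [hD.qAdd_condEntropy hq hτ.ne hcont ha hfab hn hm, hD.eq_qSmul_tsallis (by nlinarith),
      tsallis_joint hR]

lemma toAdd_uniform_two (hD : IsEntropy q τ D) :
    toAdd q (D 2 (uniform 2 le_rfl)) = -τ * toAdd q (tsallis q (uniform 2 le_rfl)) := by
  rw [hD.eq_qSmul_tsallis le_rfl, qSmul, toAdd_ofAdd]

lemma parameter_unique {τ' : ℝ} (hD : IsEntropy q τ D) (hD' : IsEntropy q τ' D) : τ = τ' :=
  neg_injective (mul_right_cancel₀ (toAdd_tsallis_uniform_two_pos q).ne'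
    (hD.toAdd_uniform_two.symm.trans hD'.toAdd_uniform_two))

lemma nonconstant (hD : IsEntropy q τ D) (hq : q ≠ 0) (hτ : τ ≠ 0) : Nonconstant D := by
  refine ⟨2, le_rfl, uniform 2 le_rfl, restrict ((isDist_unif le_rfl).mono one_le_two), ?_⟩
  intro heq
  have h0 : tsallis q (restrict ((isDist_unif le_rfl).mono one_le_two)) = 0 := by
    simp [tsallis, restrict, unif, tsallisTerm_zero hq, tsallisTerm_one]
  have hu := hD.toAdd_uniform_two
  rw [heq, hD.eq_qSmul_tsallis le_rfl, h0, qSmul_zero, toAdd_zero] at hu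
  exact mul_ne_zero (neg_ne_zero.2 hτ) (toAdd_tsallis_uniform_two_pos q).ne' hu.symm

end IsEntropy

end Entropy

section Classification

variable {q τ : ℝ} {D D' : (n : ℕ) → Δ n → ℝ} {f : ℝ → ℝ}

lemma Axioms.one_add_pos (h : Axioms q D f) (hc : Nonconstant D) {x : ℝ} (hx : x ∈ values D) :
    0 < 1 + (1 - q) * x :=
  (h.isSeqEntropy hc).one_add_pos (seqValues_seqOf h.expandable ▸ hx)

lemma Axioms.eq_of_uniform_two_eq (h : Axioms q D f) (h' : Axioms q D' f) (hc : Nonconstant D)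
    (hc' : Nonconstant D') (h2 : D 2 (uniform 2 le_rfl) = D' 2 (uniform 2 le_rfl)) {n : ℕ}
    (hn : 2 ≤ n) (P : Δ n) : D n P = D' n P := by
  have hunif : seqOf D (unif 2) = seqOf D' (unif 2) := by
    rw [seqOf_eq h.expandable le_rfl (isDist_unif one_le_two),
      seqOf_eq h'.expandable le_rfl (isDist_unif one_le_two), restrict_unif le_rfl, h2]
  have heq := (h.isSeqEntropy hc).toAdd_comp.eq_of_unif_two_eq (h'.isSeqEntropy hc').toAdd_comp
    (congrArg (toAdd q) hunif) (isDist_extend P)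
  simp only [seqOf_extend h.expandable hn, seqOf_extend h'.expandable hn] at heq
  rw [← ofAdd_toAdd (h.one_add_pos hc ⟨n, hn, P, rfl⟩), heq,
    ofAdd_toAdd (h'.one_add_pos hc' ⟨n, hn, P, rfl⟩)]

lemma Axioms.exists_gen_eq (hq : 0 < q) (h : Axioms q D f) (hc : Nonconstant D) :
    ∃ τ < 0, toAdd q (D 2 (uniform 2 le_rfl)) = -τ * toAdd q (tsallis q (uniform 2 le_rfl)) ∧
      ∃ a b : ℝ, a ≠ 0 ∧ ∀ h ≥ 0, f (ofAdd q h) = a * ofAdd q (-1 / τ * h) + b := by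
  have hH := (h.isSeqEntropy hc).toAdd_comp
  obtain ⟨s, c, b, hc0, hexp, hgen⟩ := hH.exists_gen_eq hq
  have hL := hH.unif_two_pos
  rw [seqOf_eq h.expandable le_rfl (isDist_unif one_le_two), restrict_unif le_rfl] at hexp hL
  set L := toAdd q (D 2 (uniform 2 le_rfl))
  set ρ := toAdd q (tsallis q (uniform 2 le_rfl))
  have hρ : 0 < ρ := toAdd_tsallis_uniform_two_pos q
  have ht : -1 / -(L / ρ) = ρ / L := by field_simp
  have hsc : (1 - s) * c = (1 - q) * (ρ / L) := by
    rw [← mul_div_assoc, one_sub_mul_toAdd_tsallis_uniform_two, ← hexp, ← mul_assoc,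
      mul_div_cancel_right₀ _ hL.ne']
  refine ⟨-(L / ρ), neg_neg_of_pos (div_pos hL hρ), by field_simp, c / (ρ / L), b,
    div_ne_zero hc0 (div_pos hρ hL).ne', fun h hh => ?_⟩
  rw [hgen h hh, ht, ofAdd_mul_eq (div_pos hρ hL).ne' hsc hc0]

lemma isEntropy_entropy (q τ : ℝ) : IsEntropy q τ fun _ => entropy q τ := fun _ _ _ => rfl

theorem Axioms.exists_isEntropy (hq : 0 < q) (h : Axioms q D f) (hc : Nonconstant D) :
    ∃ τ < 0, IsEntropy q τ D ∧
      ∃ a b : ℝ, a ≠ 0 ∧ ∀ x ∈ values D, f x = a * generator q τ x + b := by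
  obtain ⟨τ, hτ, hL, a, b, ha, hf⟩ := h.exists_gen_eq hq hc
  have hE := isEntropy_entropy q τ
  have hEc := hE.nonconstant hq.ne' hτ.ne
  have hgen : ∀ {x}, 0 < 1 + (1 - q) * x → 0 ≤ x → f x = a * qSmul q (-1 / τ) x + b :=
    fun hx hx0 => by rw [qSmul, ← hf _ (toAdd_nonneg hx hx0), ofAdd_toAdd hx]
  have hE' : Axioms q (fun _ => entropy q τ) f := by
    refine hE.axioms hq hτ ((affine_generator_iff hτ.ne fun x => hE.one_add_pos).2 ⟨a, b, ha, ?_⟩)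
    rintro _ ⟨n, hn, P, rfl⟩
    exact hgen (hE.one_add_pos ⟨n, hn, P, rfl⟩) (hE.nonneg hq hτ.le hn P)
  have h2 : D 2 (uniform 2 le_rfl) = entropy q τ (uniform 2 le_rfl) := by
    rw [← ofAdd_toAdd (h.one_add_pos hc ⟨2, le_rfl, _, rfl⟩), hL, ← hE.toAdd_uniform_two,
      ofAdd_toAdd (hE.one_add_pos ⟨2, le_rfl, _, rfl⟩)]
  refine ⟨τ, hτ, fun n hn => h.eq_of_uniform_two_eq hE' hc hEc h2 hn,
    (affine_generator_iff hτ.ne fun x => h.one_add_pos hc).2 ⟨a, b, ha, ?_⟩⟩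
  rintro _ ⟨n, hn, P, rfl⟩
  exact hgen (h.one_add_pos hc ⟨n, hn, P, rfl⟩) (h.nonneg n hn P)

end Classification

end GSK

theorem theorem2 (q : ℝ) (hq : 0 < q) (D : (n : ℕ) → GSK.Δ n → ℝ) :
    (((∃ f : ℝ → ℝ, GSK.Axioms q D f) ∧ GSK.Nonconstant D) ↔
      ∃ τ : ℝ, τ < 0 ∧ ∀ n : ℕ, 2 ≤ n → ∀ P : GSK.Δ n, D n P = GSK.entropy q τ P) ∧
    (∀ τ : ℝ, τ < 0 → (∀ n : ℕ, 2 ≤ n → ∀ P : GSK.Δ n, D n P = GSK.entropy q τ P) →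
      ∀ f : ℝ → ℝ, GSK.Axioms q D f ↔
        ∃ a b : ℝ, a ≠ 0 ∧ ∀ x ∈ GSK.values D, f x = a * GSK.generator q τ x + b) := by
  refine ⟨⟨?_, ?_⟩, fun τ hτ (hD : GSK.IsEntropy q τ D) f => ⟨fun h => ?_, hD.axioms hq hτ⟩⟩
  · rintro ⟨⟨f, h⟩, hc⟩
    obtain ⟨τ, hτ, hD, -⟩ := h.exists_isEntropy hq hc
    exact ⟨τ, hτ, hD⟩
  · rintro ⟨τ, hτ, hD : GSK.IsEntropy q τ D⟩
    exact ⟨⟨GSK.generator q τ, hD.axioms hq hτ ⟨1, 0, one_ne_zero, fun x _ => by ring⟩⟩,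
      hD.nonconstant hq.ne' hτ.ne⟩
  · obtain ⟨τ', -, hD', hf⟩ := h.exists_isEntropy hq (hD.nonconstant hq.ne' hτ.ne)
    rwa [hD.parameter_unique hD']
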